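/- For complex numbers $x\neq 0$, $q\ne 0$ and $p$ with $0<|p|<1$, and for an integer $n\ge 0$, put $$\theta(x;p)=\prod_{i=0}^{\infty}(1-xp^i)(1-p^{i+1}/x),\qquad (x;q,p)_n=\prod_{j=0}^{n-1}\theta(xq^j;p),$$ and $(x_1,\dots,x_m;q,p)_n=(x_1;q,p)_n\cdots(x_m;q,p)_n$. Let $a,b,q$ be nonzero complex numbers, let $p\in\mathbb{C}$ with $0<|p|<1$, and let $n\ge 0$ be an integer. Then $$\sum_{k=0}^n \frac{\theta(a^2q^{4k};p^2)}{\theta(a^2;p^2)}\, \frac{(a^2,b/q;q^2,p^2)_k}{(q^2,a^2q^3/b;q^2,p^2)_k}\, \frac{(aq^n/b,q^{-n};q,p)_k}{(bq^{1-n},aq^{n+1};q,p)_k}\,q^{2k} =\frac{\theta(-aq^{2n}/b;p)}{\theta(-a/b;p)}\, \frac{(-a/b,aq;q,p)_n}{(-q,1/b;q,p)_n}\, \frac{(1/(bq);q^2,p^2)_n}{(a^2q^3/b;q^2,p^2)_n}\,q^n,$$ provided that none of the denominators vanishes, that is, provided that $\theta(a^2;p^2)$, $\theta(-a/b;p)$,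 $(q^2,a^2q^3/b;q^2,p^2)_n$, $(bq^{1-n},aq^{n+1};q,p)_n$ and $(-q,1/b;q,p)_n$ are all nonzero. -/

import Mathlib

noncomputable section

/-- The theta function `θ(a; p) = ∏_{i ≥ 0} (1 - a pⁱ) (1 - pⁱ⁺¹ / a)`, for `a ≠ 0` and
`0 < |p| < 1` (where the infinite product converges absolutely). -/
def ellTheta (a p : ℂ) : ℂ :=
  ∏' i : ℕ, ((1 - a * p ^ i) * (1 - p ^ (i + 1) / a))

/-- The elliptic shifted factorial `(a; q, p)_n = ∏_{j=0}^{n-1} θ(a qʲ; p)`. -/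
def ellFac (a q p : ℂ) (n : ℕ) : ℂ :=
  ∏ j ∈ Finset.range n, ellTheta (a * q ^ j) p

end

/-!
The sum is evaluated by induction on `n`, along a four-term relation which both sides satisfy in
common. With `A = a / b`, the relation connects the parameters `(n + 2; a, b q²)`,
`(n + 1; a q², b q²)`, `(n + 1; a, b)` and `(n; a, b)`, with coefficients that do not depend on the
summation index.

* For the summands (`quadCoeff_relation`) the relation consists of two instances of Weierstrass'
  addition formula `ellTheta_weierstrass`, one of nome `p²` and one of nome `p`.
* For the closed forms (`quadProduct_relation`) it is equivalent to a relation between theta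
  functions of both nomes, `ellTheta_four_term`, which Landen's transformation and Weierstrass'
  formula reduce to an identity of the type of Jacobi's quartic identity, `ellTheta_quartic`.

Both theta function inputs come from Landen's transformation `exists_landen`, which writes
`θ(u; p) θ(v; p)` by theta functions of nome `p²` in `u v` and `u / v`. It follows from the Jacobi
triple product `ellTheta_eq_tsum` by sorting the double series according to parity, and the
triple product in turn is the limit of its finite form.

The induction divides by theta functions that are not among the denominators of the theorem, and its
shifted parameters may hit their zeros. It is therefore carried out for generic parameters only
(`sum_quadSummand_eq`), such that `A`, `b`, `A b` and `A² b` avoid a countable set. Every choice of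
parameters is a limit of generic ones along a curve on which `q`, `p` and `n` are fixed, and both
sides are continuous wherever the denominators do not vanish (`sum_quadSummand_eq_quadProduct`).
-/

/-! ### Basic properties of the theta function -/

/-- The infinite `p`-shifted factorial `(x; p)_∞ = ∏_{i ≥ 0} (1 - x pⁱ)`. -/
noncomputable def qPochInf (x p : ℂ) : ℂ := ∏' i : ℕ, (1 - x * p ^ i)

section Theta

variable {p : ℂ}

theorem summable_norm_neg_mul_pow (hp1 : ‖p‖ < 1) (x : ℂ) :
    Summable fun i : ℕ => ‖-(x * p ^ i)‖ := by
  simpa [norm_mul, norm_pow] using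
    (summable_geometric_of_lt_one (norm_nonneg _) hp1).mul_left ‖x‖

theorem multipliable_qPochInf (hp1 : ‖p‖ < 1) (x : ℂ) :
    Multipliable fun i : ℕ => 1 - x * p ^ i := by
  simpa [sub_eq_add_neg] using multipliable_one_add_of_summable (summable_norm_neg_mul_pow hp1 x)

theorem qPochInf_eq_one_sub_mul (hp1 : ‖p‖ < 1) (x : ℂ) :
    qPochInf x p = (1 - x) * qPochInf (p * x) p := by
  have h := multipliable_qPochInf hp1 (p * x)
  have e : (fun i : ℕ => 1 - p * x * p ^ i) = fun i : ℕ => 1 - x * p ^ (i + 1) := by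
    funext i; ring
  rw [e] at h
  rw [qPochInf, tprod_eq_zero_mul' (f := fun i : ℕ => 1 - x * p ^ i) h, qPochInf, e]
  simp

theorem exists_pow_of_qPochInf_eq_zero (hp1 : ‖p‖ < 1) {x : ℂ} (h : qPochInf x p = 0) :
    ∃ i : ℕ, x * p ^ i = 1 := by
  by_contra! hc
  refine tprod_one_add_ne_zero_of_summable (fun i => ?_) (summable_norm_neg_mul_pow hp1 x)
    (by simpa [qPochInf, sub_eq_add_neg] using h)
  rw [← sub_eq_add_neg]
  exact sub_ne_zero.mpr (hc i).symm

theorem continuous_qPochInf (hp1 : ‖p‖ < 1) : Continuous fun x => qPochInf x p := by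
  rw [continuous_iff_continuousAt]
  intro x
  have hu : Summable fun i : ℕ => (‖x‖ + 1) * ‖p‖ ^ i :=
    (summable_geometric_of_lt_one (norm_nonneg _) hp1).mul_left _
  have h := hu.hasProdLocallyUniformlyOn_nat_one_add (f := fun i (y : ℂ) => -(y * p ^ i))
    (Metric.isOpen_ball (x := (0 : ℂ)) (ε := ‖x‖ + 1))
    (Filter.Eventually.of_forall fun i y hy => by
      rw [norm_neg, norm_mul, norm_pow]
      gcongr
      simpa using (Metric.mem_ball.mp hy).le)
    (fun i => by fun_prop)
  have hc := h.tendstoLocallyUniformlyOn_finsetRange.continuousOn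
    (Filter.Frequently.of_forall fun N => by fun_prop)
  have := hc.continuousAt (Metric.isOpen_ball.mem_nhds
      (by simp : x ∈ Metric.ball (0 : ℂ) (‖x‖ + 1)))
  simpa [qPochInf, sub_eq_add_neg] using this

theorem ellTheta_eq_qPochInf_mul (hp1 : ‖p‖ < 1) (x : ℂ) :
    ellTheta x p = qPochInf x p * qPochInf (p / x) p := by
  have e : ∀ i : ℕ, p ^ (i + 1) / x = p / x * p ^ i := fun i => by ring
  simp only [ellTheta, qPochInf, e]
  exact (multipliable_qPochInf hp1 x).tprod_mul (multipliable_qPochInf hp1 (p / x))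

/-- The theta function vanishes only on the multiplicative lattice `p ^ ℤ`. -/
theorem exists_zpow_of_ellTheta_eq_zero (hp0 : 0 < ‖p‖) (hp1 : ‖p‖ < 1) {x : ℂ} (hx : x ≠ 0)
    (h : ellTheta x p = 0) : ∃ m : ℤ, x = p ^ m := by
  have hp : p ≠ 0 := norm_pos_iff.mp hp0
  rw [ellTheta_eq_qPochInf_mul hp1, mul_eq_zero] at h
  rcases h with h | h <;> obtain ⟨i, hi⟩ := exists_pow_of_qPochInf_eq_zero hp1 h
  · exact ⟨-i, by rw [zpow_neg, zpow_natCast]; exact eq_inv_of_mul_eq_one_left hi⟩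
  · refine ⟨(i + 1 : ℕ), ?_⟩
    rw [zpow_natCast]
    field_simp at hi
    rw [pow_succ']; exact hi.symm

theorem ellTheta_one (hp1 : ‖p‖ < 1) : ellTheta 1 p = 0 := by
  rw [ellTheta_eq_qPochInf_mul hp1, qPochInf_eq_one_sub_mul hp1]; simp

/-- Quasi-periodicity of the theta function under `x ↦ p x`. -/
theorem ellTheta_mul_left (hp0 : 0 < ‖p‖) (hp1 : ‖p‖ < 1) {x : ℂ} (hx : x ≠ 0) :
    ellTheta (p * x) p = -ellTheta x p / x := by
  have hp : p ≠ 0 := norm_pos_iff.mp hp0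
  rw [ellTheta_eq_qPochInf_mul hp1, ellTheta_eq_qPochInf_mul hp1, qPochInf_eq_one_sub_mul hp1 x,
    qPochInf_eq_one_sub_mul hp1 (p / (p * x)), show p * (p / (p * x)) = p / x by field_simp]
  field_simp
  ring

theorem ellTheta_inv (hp1 : ‖p‖ < 1) {x : ℂ} (hx : x ≠ 0) :
    ellTheta x⁻¹ p = -ellTheta x p / x := by
  rw [ellTheta_eq_qPochInf_mul hp1, ellTheta_eq_qPochInf_mul hp1, qPochInf_eq_one_sub_mul hp1 x,
    qPochInf_eq_one_sub_mul hp1 x⁻¹, div_inv_eq_mul, ← div_eq_mul_inv]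
  field_simp
  ring

/-- Reflection: `θ(p / x; p) = θ(x; p)`. -/
theorem ellTheta_div_left (hp0 : 0 < ‖p‖) (hp1 : ‖p‖ < 1) (x : ℂ) :
    ellTheta (p / x) p = ellTheta x p := by
  have hp : p ≠ 0 := norm_pos_iff.mp hp0
  rw [ellTheta_eq_qPochInf_mul hp1, ellTheta_eq_qPochInf_mul hp1, mul_comm,
    div_div_cancel₀ hp]

theorem continuousAt_ellTheta (hp1 : ‖p‖ < 1) {x : ℂ} (hx : x ≠ 0) :
    ContinuousAt (fun y => ellTheta y p) x := by
  have h : (fun y => ellTheta y p) = fun y => qPochInf y p * qPochInf (p / y) p :=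
    funext fun y => ellTheta_eq_qPochInf_mul hp1 y
  rw [h]
  have hc := continuous_qPochInf hp1
  exact hc.continuousAt.mul
    (hc.continuousAt.comp (f := fun y => p / y) (continuousAt_const.div continuousAt_id hx))

theorem norm_sq_lt_one (hp1 : ‖p‖ < 1) : ‖p ^ 2‖ < 1 := by
  rw [norm_pow]; exact pow_lt_one₀ (norm_nonneg _) hp1 two_ne_zero

theorem norm_sq_pos (hp0 : 0 < ‖p‖) : 0 < ‖p ^ 2‖ := by
  rw [norm_pow]; positivity

/-- Factorization of a theta function of nome `p²` at a square. -/
theorem ellTheta_sq (hp1 : ‖p‖ < 1) (x : ℂ) :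
    ellTheta (x ^ 2) (p ^ 2) = ellTheta x p * ellTheta (-x) p := by
  have key : ∀ y, qPochInf (y ^ 2) (p ^ 2) = qPochInf y p * qPochInf (-y) p := fun y => by
    rw [qPochInf, qPochInf, qPochInf,
      ← (multipliable_qPochInf hp1 y).tprod_mul (multipliable_qPochInf hp1 (-y))]
    exact tprod_congr fun i => by ring
  rw [ellTheta_eq_qPochInf_mul (norm_sq_lt_one hp1), ellTheta_eq_qPochInf_mul hp1,
    ellTheta_eq_qPochInf_mul hp1, ← div_pow, key, key, div_neg]
  ring

/-- Splitting a theta function of nome `p` into two theta functions of nome `p²`. -/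
theorem ellTheta_split (hp0 : 0 < ‖p‖) (hp1 : ‖p‖ < 1) (x : ℂ) :
    ellTheta x p = ellTheta x (p ^ 2) * ellTheta (p * x) (p ^ 2) := by
  have hp : p ≠ 0 := norm_pos_iff.mp hp0
  have h2 := norm_sq_lt_one hp1
  have key : ∀ y, qPochInf y p = qPochInf y (p ^ 2) * qPochInf (p * y) (p ^ 2) := fun y => by
    have e0 : ∀ k : ℕ, y * (p ^ 2) ^ k = y * p ^ (2 * k) := fun k => by ring
    have e1 : ∀ k : ℕ, p * y * (p ^ 2) ^ k = y * p ^ (2 * k + 1) := fun k => by ring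
    have m0 := multipliable_qPochInf h2 y
    have m1 := multipliable_qPochInf h2 (p * y)
    simp only [e0] at m0
    simp only [e1] at m1
    simp only [qPochInf, e0, e1]
    exact (tprod_even_mul_odd (f := fun k : ℕ => 1 - y * p ^ k) m0 m1).symm
  rw [ellTheta_eq_qPochInf_mul hp1, ellTheta_eq_qPochInf_mul h2, ellTheta_eq_qPochInf_mul h2,
    key x, key (p / x), show p ^ 2 / (p * x) = p / x by field_simp,
    show p * (p / x) = p ^ 2 / x by ring]
  ring

end Theta

/-! ### The Jacobi triple product -/

section TripleProduct

open Filter Topology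

/-- The finite `p`-shifted factorial `(p; p)_N = ∏_{i=1}^N (1 - pⁱ)`. -/
noncomputable def qPochSelf (p : ℂ) (N : ℕ) : ℂ := ∏ i ∈ Finset.range N, (1 - p * p ^ i)

/-- The reciprocal `1 / (p; p)_m`, extended by zero to negative `m`, so that
`1 / (p; p)_{m-1} = (1 - pᵐ) / (p; p)_m` for all integers `m`. -/
noncomputable def qPochSelfRecip (p : ℂ) (m : ℤ) : ℂ :=
  if 0 ≤ m then (qPochSelf p m.toNat)⁻¹ else 0

/-- The coefficient `(-1)ʲ p^{j(j-1)/2}` of the theta series, written in terms of a square root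
`r` of the nome `p` in order to avoid halving the exponent. -/
noncomputable def thetaCoeff (r : ℂ) (j : ℤ) : ℂ := (-1) ^ j * r ^ (j * (j - 1))

variable {p r : ℂ}

theorem one_sub_mul_pow_ne_zero (hp1 : ‖p‖ < 1) (i : ℕ) : 1 - p * p ^ i ≠ 0 := by
  intro h
  have : ‖p * p ^ i‖ < 1 := by
    rw [← pow_succ', norm_pow]; exact pow_lt_one₀ (norm_nonneg _) hp1 (by simp)
  rw [← sub_eq_zero.mp h] at this
  simp at this

theorem qPochSelf_ne_zero (hp1 : ‖p‖ < 1) (N : ℕ) : qPochSelf p N ≠ 0 :=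
  Finset.prod_ne_zero_iff.mpr fun i _ => one_sub_mul_pow_ne_zero hp1 i

theorem qPochInf_self_ne_zero (hp1 : ‖p‖ < 1) : qPochInf p p ≠ 0 := fun h => by
  obtain ⟨i, hi⟩ := exists_pow_of_qPochInf_eq_zero hp1 h
  exact one_sub_mul_pow_ne_zero hp1 i (by rw [hi, sub_self])

theorem tendsto_qPochSelf (hp1 : ‖p‖ < 1) :
    Tendsto (qPochSelf p) atTop (𝓝 (qPochInf p p)) :=
  (multipliable_qPochInf hp1 p).tendsto_prod_tprod_nat

theorem qPochSelfRecip_sub_one (hp1 : ‖p‖ < 1) (m : ℤ) :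
    qPochSelfRecip p (m - 1) = (1 - p ^ m) * qPochSelfRecip p m := by
  unfold qPochSelfRecip
  rcases lt_trichotomy m 0 with h | h | h
  · rw [if_neg (by omega), if_neg (by omega), mul_zero]
  · subst h; simp
  · obtain ⟨k, rfl⟩ : ∃ k : ℕ, m = k + 1 := ⟨(m - 1).toNat, by omega⟩
    rw [if_pos (by omega), if_pos (by omega), add_sub_cancel_right, Int.toNat_natCast,
      show ((k : ℤ) + 1).toNat = k + 1 by omega, qPochSelf, qPochSelf, Finset.prod_range_succ]
    have := one_sub_mul_pow_ne_zero hp1 k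
    have e : p ^ ((k : ℤ) + 1) = p * p ^ k := by
      rw [← pow_succ']; exact_mod_cast zpow_natCast p (k + 1)
    rw [e]
    have h2 := qPochSelf_ne_zero hp1 k
    rw [qPochSelf] at h2
    field_simp

theorem thetaCoeff_sub_one (hp : p ≠ 0) (hr : r ^ 2 = p) (j : ℤ) :
    thetaCoeff r (j - 1) = -thetaCoeff r j * (p / p ^ j) := by
  have hr0 : r ≠ 0 := by rintro rfl; simp at hr; exact hp hr.symm
  have h2 : r ^ (2 : ℤ) = p := by exact_mod_cast hr
  have e : (j - 1) * (j - 1 - 1) = j * (j - 1) + (2 - 2 * j) := by ring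
  rw [thetaCoeff, thetaCoeff, e, zpow_add₀ hr0, zpow_sub₀ hr0, zpow_mul r 2 j,
    zpow_sub₀ (by simp), h2, zpow_one]
  ring

theorem thetaCoeff_add_one (hp : p ≠ 0) (hr : r ^ 2 = p) (j : ℤ) :
    thetaCoeff r (j + 1) = -thetaCoeff r j * p ^ j := by
  have hr0 : r ≠ 0 := by rintro rfl; simp at hr; exact hp hr.symm
  have h2 : r ^ (2 : ℤ) = p := by exact_mod_cast hr
  have e : (j + 1) * (j + 1 - 1) = j * (j - 1) + 2 * j := by ring
  rw [thetaCoeff, thetaCoeff, e, zpow_add₀ hr0, zpow_mul r 2 j, zpow_add₀ (by simp), h2,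
    zpow_one]
  ring

/-- The finite form of the Jacobi triple product (a case of the `q`-binomial theorem). -/
theorem hasSum_finite_tripleProduct (hp : p ≠ 0) (hp1 : ‖p‖ < 1) (hr : r ^ 2 = p) {x : ℂ}
    (hx : x ≠ 0) (N : ℕ) :
    HasSum (fun j : ℤ => qPochSelf p (2 * N) * qPochSelfRecip p (N - j) * qPochSelfRecip p (N + j)
        * thetaCoeff r j * x ^ j)
      (∏ i ∈ Finset.range N, ((1 - x * p ^ i) * (1 - p ^ (i + 1) / x))) := by
  induction N with
  | zero =>
    convert hasSum_single (0 : ℤ) ?_ using 1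
    · simp [qPochSelf, qPochSelfRecip, thetaCoeff]
    · intro j hj
      rcases lt_or_gt_of_ne hj with h | h
      · simp [qPochSelfRecip, show ¬ (0 ≤ j) by omega]
      · simp [qPochSelfRecip, show ¬ (j ≤ 0) by omega]
  | succ N ih =>
    -- multiplication by `x` and `1 / x` shifts the summation index
    have h1 := (Equiv.subRight (1 : ℤ)).hasSum_iff.mpr ih
    have h2 := (Equiv.addRight (1 : ℤ)).hasSum_iff.mpr ih
    rw [Finset.prod_range_succ]
    have h3 := ((ih.mul_left (1 + p ^ (2 * N + 1))).sub (h1.mul_left (x * p ^ N))).sub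
      (h2.mul_left (p ^ (N + 1) / x))
    rw [show ∀ P : ℂ, (1 + p ^ (2 * N + 1)) * P - x * p ^ N * P - p ^ (N + 1) / x * P
      = P * ((1 - x * p ^ N) * (1 - p ^ (N + 1) / x)) from fun P => by field_simp; ring] at h3
    refine h3.congr_fun fun j => ?_
    · simp only [Function.comp, Equiv.subRight_apply, Equiv.coe_addRight]
      have hv : p ^ j ≠ 0 := zpow_ne_zero _ hp
      have eQ : qPochSelf p (2 * (N + 1))
          = qPochSelf p (2 * N) * (1 - p * p ^ (2 * N)) * (1 - p * p ^ (2 * N + 1)) := by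
        rw [qPochSelf, show 2 * (N + 1) = 2 * N + 1 + 1 by ring, Finset.prod_range_succ,
          Finset.prod_range_succ, qPochSelf]
      have s1 := qPochSelfRecip_sub_one hp1 ((N : ℤ) + 1 - j)
      have s2 := qPochSelfRecip_sub_one hp1 ((N : ℤ) + 1 + j)
      have s3 := qPochSelfRecip_sub_one hp1 ((N : ℤ) - j)
      have s4 := qPochSelfRecip_sub_one hp1 ((N : ℤ) + j)
      rw [show (N : ℤ) + 1 - j - 1 = N - j by ring] at s1
      rw [show (N : ℤ) + 1 + j - 1 = N + j by ring] at s2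
      rw [show (N : ℤ) - (j - 1) = N + 1 - j by ring, show (N : ℤ) + (j - 1) = N + j - 1 by ring,
        show (N : ℤ) - (j + 1) = N - j - 1 by ring, show (N : ℤ) + (j + 1) = N + 1 + j by ring,
        s3, s4, s1, s2, eQ, thetaCoeff_sub_one hp hr, thetaCoeff_add_one hp hr]
      push_cast
      simp only [zpow_add₀ hp, zpow_sub₀ hp, zpow_add₀ hx, zpow_sub₀ hx, zpow_one, zpow_natCast]
      field_simp
      ring

theorem summable_norm_thetaCoeff (hp : p ≠ 0) (hp1 : ‖p‖ < 1) (hr : r ^ 2 = p) {x : ℂ}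
    (hx : x ≠ 0) : Summable fun j : ℤ => ‖thetaCoeff r j * x ^ j‖ := by
  have hr0 : r ≠ 0 := by rintro rfl; simp at hr; exact hp hr.symm
  have hne : ∀ j : ℤ, thetaCoeff r j * x ^ j ≠ 0 := fun j =>
    mul_ne_zero (mul_ne_zero (zpow_ne_zero _ (by simp)) (zpow_ne_zero _ hr0)) (zpow_ne_zero _ hx)
  have hz : Tendsto (fun n : ℕ => p ^ n) atTop (𝓝 0) :=
    tendsto_pow_atTop_nhds_zero_of_norm_lt_one hp1
  refine Summable.of_nat_of_neg ?_ ?_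
  · refine summable_of_ratio_test_tendsto_lt_one zero_lt_one
      (.of_forall fun n => norm_ne_zero_iff.mpr (hne _)) ?_
    have h : Tendsto (fun n : ℕ => ‖-(p ^ n * x)‖) atTop (𝓝 0) := by
      simpa using (hz.mul_const x).neg.norm
    refine h.congr fun n => ?_
    rw [norm_norm, norm_norm, ← norm_div]
    congr 1
    rw [eq_div_iff (hne _)]
    push_cast
    rw [thetaCoeff_add_one hp hr, zpow_add₀ hx]
    simp; ring
  · refine summable_of_ratio_test_tendsto_lt_one zero_lt_one
      (.of_forall fun n => norm_ne_zero_iff.mpr (hne _)) ?_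
    have h : Tendsto (fun n : ℕ => ‖-(p ^ n * (p / x))‖) atTop (𝓝 0) := by
      simpa using (hz.mul_const (p / x)).neg.norm
    refine h.congr fun n => ?_
    rw [norm_norm, norm_norm, ← norm_div]
    congr 1
    rw [eq_div_iff (hne _)]
    push_cast
    rw [show -((n : ℤ) + 1) = -n - 1 by ring, thetaCoeff_sub_one hp hr, zpow_sub₀ hx]
    simp; ring

theorem exists_norm_qPochSelfRecip_le (hp1 : ‖p‖ < 1) :
    ∃ C, 0 ≤ C ∧ ∀ m, ‖qPochSelfRecip p m‖ ≤ C := by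
  obtain ⟨C, hC⟩ := ((tendsto_qPochSelf hp1).inv₀ (qPochInf_self_ne_zero hp1)).norm.bddAbove_range
  have hC' : ∀ N, ‖(qPochSelf p N)⁻¹‖ ≤ C := fun N => hC ⟨N, rfl⟩
  have h0 : 0 ≤ C := (norm_nonneg _).trans (hC' 0)
  refine ⟨C, h0, fun m => ?_⟩
  unfold qPochSelfRecip
  split_ifs
  · exact hC' _
  · simpa using h0

theorem tendsto_qPochSelfRecip (hp1 : ‖p‖ < 1) :
    Tendsto (qPochSelfRecip p) atTop (𝓝 (qPochInf p p)⁻¹) := by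
  have h := ((tendsto_qPochSelf hp1).inv₀ (qPochInf_self_ne_zero hp1)).comp
    (tendsto_atTop_atTop.mpr fun b : ℕ => ⟨(b : ℤ), fun a ha => by omega⟩ :
      Tendsto Int.toNat atTop atTop)
  refine h.congr' ?_
  filter_upwards [eventually_ge_atTop 0] with m hm
  simp [qPochSelfRecip, hm]

/-- The Jacobi triple product identity. -/
theorem ellTheta_eq_tsum (hp : p ≠ 0) (hp1 : ‖p‖ < 1) (hr : r ^ 2 = p) {x : ℂ} (hx : x ≠ 0) :
    ellTheta x p = (qPochInf p p)⁻¹ * ∑' j : ℤ, thetaCoeff r j * x ^ j := by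
  have hprod : Tendsto (fun N : ℕ => ∏ i ∈ Finset.range N,
      ((1 - x * p ^ i) * (1 - p ^ (i + 1) / x))) atTop (𝓝 (ellTheta x p)) := by
    have e : ∀ i : ℕ, p ^ (i + 1) / x = p / x * p ^ i := fun i => by ring
    simp only [ellTheta_eq_qPochInf_mul hp1, Finset.prod_mul_distrib, e]
    exact (multipliable_qPochInf hp1 x).tendsto_prod_tprod_nat.mul
      (multipliable_qPochInf hp1 (p / x)).tendsto_prod_tprod_nat
  obtain ⟨C, hC0, hC⟩ := exists_norm_qPochSelfRecip_le hp1
  obtain ⟨B, hB⟩ := (tendsto_qPochSelf hp1).norm.bddAbove_range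
  have hB' : ∀ N, ‖qPochSelf p N‖ ≤ B := fun N => hB ⟨N, rfl⟩
  have hB0 : 0 ≤ B := (norm_nonneg _).trans (hB' 0)
  have hsum := tendsto_tsum_of_dominated_convergence (𝓕 := atTop)
    (f := fun (N : ℕ) (j : ℤ) => qPochSelf p (2 * N) * qPochSelfRecip p (N - j)
      * qPochSelfRecip p (N + j) * thetaCoeff r j * x ^ j)
    (g := fun j : ℤ => (qPochInf p p)⁻¹ * (thetaCoeff r j * x ^ j))
    (bound := fun j : ℤ => B * C * C * ‖thetaCoeff r j * x ^ j‖)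
    ((summable_norm_thetaCoeff hp hp1 hr hx).mul_left _) (fun j => ?_)
    (.of_forall fun N j => ?_)
  · rw [tsum_mul_left] at hsum
    exact tendsto_nhds_unique hprod
      (hsum.congr fun N => (hasSum_finite_tripleProduct hp hp1 hr hx N).tsum_eq)
  · have t0 : Tendsto (fun N : ℕ => qPochSelf p (2 * N)) atTop (𝓝 (qPochInf p p)) :=
      (tendsto_qPochSelf hp1).comp (tendsto_id.const_mul_atTop' two_pos)
    have t1 : Tendsto (fun N : ℕ => qPochSelfRecip p (N - j)) atTop (𝓝 (qPochInf p p)⁻¹) :=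
      (tendsto_qPochSelfRecip hp1).comp
        (tendsto_atTop_add_const_right _ (-j) tendsto_natCast_atTop_atTop)
    have t2 : Tendsto (fun N : ℕ => qPochSelfRecip p (N + j)) atTop (𝓝 (qPochInf p p)⁻¹) :=
      (tendsto_qPochSelfRecip hp1).comp
        (tendsto_atTop_add_const_right _ j tendsto_natCast_atTop_atTop)
    have h := ((t0.mul t1).mul t2).mul_const (thetaCoeff r j * x ^ j)
    rw [mul_inv_cancel₀ (qPochInf_self_ne_zero hp1), one_mul] at h
    exact h.congr fun N => by ring
  · rw [mul_assoc _ (thetaCoeff r j), norm_mul, norm_mul, norm_mul]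
    gcongr
    exacts [hB' _, hC _, hC _]

end TripleProduct

/-! ### Landen's transformation and Weierstrass' addition formula -/

section Landen

variable {p : ℂ}

/-- Landen's transformation: splitting the double theta series of `θ(u; p) θ(v; p)` according to
the parity of the total degree expresses it by theta functions of nome `p²`. -/
theorem exists_landen (hp0 : 0 < ‖p‖) (hp1 : ‖p‖ < 1) :
    ∃ K : ℂ, K ≠ 0 ∧ ∀ u v : ℂ, u ≠ 0 → v ≠ 0 →
      ellTheta u p * ellTheta v p
        = K * (ellTheta (-(u * v)) (p ^ 2) * ellTheta (-(p * (u / v))) (p ^ 2)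
          - v * (ellTheta (-(p * (u * v))) (p ^ 2) * ellTheta (-(u / v)) (p ^ 2))) := by
  have hp : p ≠ 0 := norm_pos_iff.mp hp0
  have hp2 : p ^ 2 ≠ 0 := pow_ne_zero _ hp
  have hn2 := norm_sq_lt_one hp1
  obtain ⟨r, hr⟩ : ∃ r : ℂ, r ^ 2 = p := IsAlgClosed.exists_pow_nat_eq p two_pos
  have hr0 : r ≠ 0 := by rintro rfl; simp at hr; exact hp hr.symm
  refine ⟨((qPochInf p p)⁻¹) ^ 2 / ((qPochInf (p ^ 2) (p ^ 2))⁻¹) ^ 2,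
    div_ne_zero (pow_ne_zero _ (inv_ne_zero (qPochInf_self_ne_zero hp1)))
      (pow_ne_zero _ (inv_ne_zero (qPochInf_self_ne_zero hn2))), fun u v hu hv => ?_⟩
  have huv : u * v ≠ 0 := mul_ne_zero hu hv
  have hudv : u / v ≠ 0 := div_ne_zero hu hv
  have hd := inv_ne_zero (qPochInf_self_ne_zero hn2)
  have s1 := summable_norm_thetaCoeff hp hp1 hr hu
  have s2 := summable_norm_thetaCoeff hp hp1 hr hv
  have a1 := summable_norm_thetaCoeff hp2 hn2 rfl (neg_ne_zero.mpr huv)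
  have a2 := summable_norm_thetaCoeff hp2 hn2 rfl (neg_ne_zero.mpr (mul_ne_zero hp hudv))
  have a3 := summable_norm_thetaCoeff hp2 hn2 rfl (neg_ne_zero.mpr (mul_ne_zero hp huv))
  have a4 := summable_norm_thetaCoeff hp2 hn2 rfl (neg_ne_zero.mpr hudv)
  have key : (∑' j : ℤ, thetaCoeff r j * u ^ j) * (∑' j : ℤ, thetaCoeff r j * v ^ j)
      = (∑' j : ℤ, thetaCoeff p j * (-(u * v)) ^ j)
        * (∑' j : ℤ, thetaCoeff p j * (-(p * (u / v))) ^ j)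
        + -v * ((∑' j : ℤ, thetaCoeff p j * (-(p * (u * v))) ^ j)
          * (∑' j : ℤ, thetaCoeff p j * (-(u / v)) ^ j)) := by
    rw [tsum_mul_tsum_of_summable_norm s1 s2, tsum_mul_tsum_of_summable_norm a1 a2,
      tsum_mul_tsum_of_summable_norm a3 a4, ← tsum_mul_left]
    -- `e` and `o` parametrize the index pairs of even and of odd sum
    let e : ℤ × ℤ → ℤ × ℤ := fun z => (z.1 + z.2, z.1 - z.2)
    let o : ℤ × ℤ → ℤ × ℤ := fun z => (z.1 + z.2, z.1 - z.2 + 1)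
    have he : Function.Injective e := fun z w h => by
      simp only [e, Prod.mk.injEq] at h; ext <;> omega
    have ho : Function.Injective o := fun z w h => by
      simp only [o, Prod.mk.injEq] at h; ext <;> omega
    have hc : IsCompl (Set.range e) (Set.range o) := by
      rw [isCompl_iff]
      constructor
      · rw [Set.disjoint_left]
        rintro _ ⟨z, rfl⟩ ⟨w, h⟩
        simp only [e, o, Prod.mk.injEq] at h; omega
      · rw [codisjoint_iff, Set.top_eq_univ, Set.eq_univ_iff_forall]
        rintro ⟨m, n⟩
        rcases Int.even_or_odd (m + n) with ⟨k, hk⟩ | ⟨k, hk⟩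
        · exact .inl ⟨(k, m - k), by simp only [e, Prod.mk.injEq]; omega⟩
        · exact .inr ⟨(k, m - k), by simp only [o, Prod.mk.injEq]; omega⟩
    refine (HasSum.add_isCompl hc (he.hasSum_range_iff.mpr ?_)
      (ho.hasSum_range_iff.mpr ?_)).tsum_eq
    · refine (summable_mul_of_summable_norm a1 a2).hasSum.congr_fun fun z => ?_
      obtain ⟨s, d⟩ := z
      simp only [Function.comp, e, thetaCoeff]
      have er : r ^ ((s + d) * (s + d - 1)) * r ^ ((s - d) * (s - d - 1))
          = p ^ (s * (s - 1)) * p ^ (d * (d - 1)) * p ^ d := by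
        rw [← zpow_add₀ hr0, ← hr, ← zpow_ofNat r 2, ← zpow_mul, ← zpow_mul, ← zpow_mul,
          ← zpow_add₀ hr0, ← zpow_add₀ hr0]
        congr 1; ring
      rw [neg_eq_neg_one_mul (u * v), neg_eq_neg_one_mul (p * (u / v)), mul_zpow, mul_zpow,
        mul_zpow, mul_zpow, div_zpow]
      have ev : v ^ (s - d) = v ^ s / v ^ d := zpow_sub₀ hv _ _
      have eu : u ^ (s + d) = u ^ s * u ^ d := zpow_add₀ hu _ _
      have e1 : (-1 : ℂ) ^ (s + d) * (-1) ^ (s - d) = (-1) ^ s * (-1) ^ s := by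
        rw [← zpow_add₀ (by simp), ← zpow_add₀ (by simp)]; congr 1; ring
      have e2 : (-1 : ℂ) ^ d * (-1) ^ d = 1 := by
        rw [← mul_zpow]; simp
      rw [ev, eu]
      linear_combination (u ^ s * u ^ d * (v ^ s / v ^ d)) *
        ((-1 : ℂ) ^ (s + d) * (-1) ^ (s - d) * er
          + p ^ (s * (s - 1)) * p ^ (d * (d - 1)) * p ^ d * (e1 - (-1) ^ s * (-1) ^ s * e2))
    · refine ((summable_mul_of_summable_norm a3 a4).mul_left (-v)).hasSum.congr_fun fun z => ?_
      obtain ⟨s, d⟩ := z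
      simp only [Function.comp, o, thetaCoeff]
      have er : r ^ ((s + d) * (s + d - 1)) * r ^ ((s - d + 1) * (s - d + 1 - 1))
          = p ^ (s * (s - 1)) * p ^ (d * (d - 1)) * p ^ s := by
        rw [← zpow_add₀ hr0, ← hr, ← zpow_ofNat r 2, ← zpow_mul, ← zpow_mul, ← zpow_mul,
          ← zpow_add₀ hr0, ← zpow_add₀ hr0]
        congr 1; ring
      rw [neg_eq_neg_one_mul (p * (u * v)), neg_eq_neg_one_mul (u / v), mul_zpow, mul_zpow,
        mul_zpow, mul_zpow, div_zpow]
      have ev : v ^ (s - d + 1) = v ^ s / v ^ d * v := by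
        rw [zpow_add_one₀ hv, zpow_sub₀ hv]
      have eu : u ^ (s + d) = u ^ s * u ^ d := zpow_add₀ hu _ _
      have e1 : (-1 : ℂ) ^ (s + d) * (-1) ^ (s - d + 1) = -((-1) ^ s * (-1) ^ s) := by
        rw [zpow_add_one₀ (by simp), mul_neg_one, mul_neg, ← zpow_add₀ (by simp),
          ← zpow_add₀ (by simp)]
        congr 2; ring
      have e2 : (-1 : ℂ) ^ d * (-1) ^ d = 1 := by
        rw [← mul_zpow]; simp
      rw [ev, eu]
      linear_combination (u ^ s * u ^ d * (v ^ s / v ^ d * v)) *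
        ((-1 : ℂ) ^ (s + d) * (-1) ^ (s - d + 1) * er
          + p ^ (s * (s - 1)) * p ^ (d * (d - 1)) * p ^ s * (e1 + (-1) ^ s * (-1) ^ s * e2))
  rw [ellTheta_eq_tsum hp hp1 hr hu, ellTheta_eq_tsum hp hp1 hr hv,
    ellTheta_eq_tsum hp2 hn2 rfl (neg_ne_zero.mpr huv),
    ellTheta_eq_tsum hp2 hn2 rfl (neg_ne_zero.mpr (mul_ne_zero hp hudv)),
    ellTheta_eq_tsum hp2 hn2 rfl (neg_ne_zero.mpr (mul_ne_zero hp huv)),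
    ellTheta_eq_tsum hp2 hn2 rfl (neg_ne_zero.mpr hudv)]
  rw [show ∀ a b c : ℂ, a * b * (a * c) = a ^ 2 * (b * c) from fun a b c => by ring, key,
    show ∀ a b c d e f : ℂ, (a * b) * (a * c) - d * ((a * e) * (a * f))
      = a ^ 2 * (b * c + -d * (e * f)) from fun a b c d e f => by ring]
  have h : ∀ a d X : ℂ, d ≠ 0 → a * X = a / d * (d * X) := fun a d X hd => by field_simp
  exact h _ _ _ (pow_ne_zero 2 hd)

/-- Weierstrass' addition formula. After Landen's transformation it is the Plücker relation
between the four vectors `(θ(-t; p²), √t θ(-pt; p²))` with `t = a X²`, `a M²`, `c² / a`, `1 / a`. -/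
theorem ellTheta_weierstrass (hp0 : 0 < ‖p‖) (hp1 : ‖p‖ < 1) {a c X M : ℂ} (ha : a ≠ 0)
    (hc : c ≠ 0) (hX : X ≠ 0) (hM : M ≠ 0) :
    ellTheta (c * X) p * ellTheta (a * X / c) p * (ellTheta M p * ellTheta (a * M) p)
      - ellTheta (c * M) p * ellTheta (a * M / c) p * (ellTheta X p * ellTheta (a * X) p)
      + M * (ellTheta (X / M) p * ellTheta (a * M * X) p * (ellTheta c p * ellTheta (a / c) p))
      = 0 := by
  obtain ⟨K, -, hK⟩ := exists_landen hp0 hp1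
  have e1 := hK (c * X) (a * X / c) (by positivity) (by positivity)
  have e2 := hK M (a * M) hM (by positivity)
  have e3 := hK (c * M) (a * M / c) (by positivity) (by positivity)
  have e4 := hK X (a * X) hX (by positivity)
  have e5 := hK (a * M * X) (X / M) (by positivity) (by positivity)
  have e6 := hK (c / a) c (by positivity) hc
  have e7 := ellTheta_inv hp1 (x := c / a) (by positivity)
  rw [inv_div] at e7
  rw [show c * X * (a * X / c) = a * X ^ 2 by field_simp,
    show c * X / (a * X / c) = c ^ 2 / a by field_simp] at e1
  rw [show M * (a * M) = a * M ^ 2 by ring, show M / (a * M) = 1 / a by field_simp] at e2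
  rw [show c * M * (a * M / c) = a * M ^ 2 by field_simp,
    show c * M / (a * M / c) = c ^ 2 / a by field_simp] at e3
  rw [show X * (a * X) = a * X ^ 2 by ring, show X / (a * X) = 1 / a by field_simp] at e4
  rw [show a * M * X * (X / M) = a * X ^ 2 by field_simp,
    show a * M * X / (X / M) = a * M ^ 2 by field_simp] at e5
  rw [show c / a * c = c ^ 2 / a by ring, show c / a / c = 1 / a by field_simp] at e6
  have e8 : ellTheta c p * ellTheta (a / c) p
      = -(a / c) * (ellTheta (c / a) p * ellTheta c p) := by rw [e7]; field_simp
  rw [e8, mul_comm (ellTheta (X / M) p), e1, e2, e3, e4, e5, e6]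
  field_simp
  ring

end Landen

/-! ### Theta function identities behind the recurrence -/

section Identities

variable {p : ℂ}

/-- A form of Jacobi's quartic theta identity: by Landen's transformation both sides are multiples
of `θ(z, q z, A z, A b q² z; p) + θ(-z, -q z, -A z, -A b q² z; p)`. -/
theorem ellTheta_quartic (hp0 : 0 < ‖p‖) (hp1 : ‖p‖ < 1) {A b q z : ℂ} (hA : A ≠ 0) (hb : b ≠ 0)
    (hq : q ≠ 0) (hz : z ≠ 0) :
    ellTheta (-(p * q)) (p ^ 2) * ellTheta (-(p * (b * q ^ 2))) (p ^ 2)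
        * (ellTheta (-(q * z ^ 2)) (p ^ 2) * ellTheta (-(A ^ 2 * b * q ^ 2 * z ^ 2)) (p ^ 2))
      + A * z ^ 2 * (ellTheta (-q) (p ^ 2) * ellTheta (-(b * q ^ 2)) (p ^ 2)
        * (ellTheta (-(p * (q * z ^ 2))) (p ^ 2)
          * ellTheta (-(p * (A ^ 2 * b * q ^ 2 * z ^ 2))) (p ^ 2)))
    = ellTheta (-(A * b * q ^ 2 * z ^ 2)) (p ^ 2) * ellTheta (-(A * q * z ^ 2)) (p ^ 2)
        * (ellTheta (-(p * (A / q))) (p ^ 2) * ellTheta (-(p * (A * b * q ^ 2))) (p ^ 2))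
      + q * z ^ 2 * (ellTheta (-(p * (A * b * q ^ 2 * z ^ 2))) (p ^ 2)
        * ellTheta (-(p * (A * q * z ^ 2))) (p ^ 2)
        * (ellTheta (-(A / q)) (p ^ 2) * ellTheta (-(A * b * q ^ 2)) (p ^ 2))) := by
  obtain ⟨K, hK0, hK⟩ := exists_landen hp0 hp1
  have a1 := hK (A * b * q ^ 2 * z) (A * z) (by positivity) (by positivity)
  have a1' := hK (-(A * b * q ^ 2 * z)) (-(A * z)) (neg_ne_zero.mpr (by positivity))
      (neg_ne_zero.mpr (by positivity))
  have a2 := hK (q * z) z (by positivity) (by positivity)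
  have a2' := hK (-(q * z)) (-z) (neg_ne_zero.mpr (by positivity)) (neg_ne_zero.mpr (by positivity))
  have b1 := hK (A * b * q ^ 2 * z) z (by positivity) (by positivity)
  have b1' := hK (-(A * b * q ^ 2 * z)) (-z) (neg_ne_zero.mpr (by positivity))
      (neg_ne_zero.mpr (by positivity))
  have b2 := hK (A * z) (q * z) (by positivity) (by positivity)
  have b2' := hK (-(A * z)) (-(q * z)) (neg_ne_zero.mpr (by positivity)) (neg_ne_zero.mpr
      (by positivity))
  rw [neg_mul_neg, neg_div_neg_eq] at a1' a2' b1' b2'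
  rw [show A * b * q ^ 2 * z * (A * z) = A ^ 2 * b * q ^ 2 * z ^ 2 by ring,
    show A * b * q ^ 2 * z / (A * z) = b * q ^ 2 by field_simp] at a1 a1'
  rw [show q * z * z = q * z ^ 2 by ring, show q * z / z = q by field_simp] at a2 a2'
  rw [show A * b * q ^ 2 * z * z = A * b * q ^ 2 * z ^ 2 by ring,
    show A * b * q ^ 2 * z / z = A * b * q ^ 2 by field_simp] at b1 b1'
  rw [show A * z * (q * z) = A * q * z ^ 2 by ring,
    show A * z / (q * z) = A / q by field_simp] at b2 b2'
  refine mul_left_cancel₀ (pow_ne_zero 2 hK0) ?_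
  trans (ellTheta (A * b * q ^ 2 * z) p * ellTheta (A * z) p * (ellTheta (q * z) p * ellTheta z p)
    + ellTheta (-(A * b * q ^ 2 * z)) p * ellTheta (-(A * z)) p
      * (ellTheta (-(q * z)) p * ellTheta (-z) p)) / 2
  · rw [a1, a1', a2, a2']; ring
  · trans (ellTheta (A * b * q ^ 2 * z) p * ellTheta z p
        * (ellTheta (A * z) p * ellTheta (q * z) p)
      + ellTheta (-(A * b * q ^ 2 * z)) p * ellTheta (-z) p
        * (ellTheta (-(A * z)) p * ellTheta (-(q * z)) p)) / 2
    · ring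
    · rw [b1, b1', b2, b2']; ring

/-- The quasi-period `p²` of theta functions of nome `p²`. -/
theorem ellTheta_sq_mul (hp0 : 0 < ‖p‖) (hp1 : ‖p‖ < 1) {x : ℂ} (hx : x ≠ 0) :
    ellTheta (p ^ 2 * x) (p ^ 2) = -ellTheta x (p ^ 2) / x :=
  ellTheta_mul_left (norm_sq_pos hp0) (norm_sq_lt_one hp1) hx

theorem ellTheta_neg_div (hp0 : 0 < ‖p‖) (hp1 : ‖p‖ < 1) {x : ℂ} (hx : x ≠ 0) :
    ellTheta (-(x / p)) (p ^ 2) = x / p * ellTheta (-(p * x)) (p ^ 2) := by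
  have hp : p ≠ 0 := norm_pos_iff.mp hp0
  have h := ellTheta_sq_mul hp0 hp1 (x := -(x / p)) (neg_ne_zero.mpr (by positivity))
  rw [show p ^ 2 * -(x / p) = -(p * x) by field_simp] at h
  rw [h]
  field_simp

/-- The left bracket of the four-term relation, for a constant `K` of Landen's transformation.
After Landen's transformation of the products of nome `p`, Weierstrass' formula of nome `p²` applies
to each of the two components and turns the bracket, multiplied by `θ(-b q²; p)`, into a multiple of
the left side of `ellTheta_quartic`. -/
theorem ellTheta_bracket_left (hp0 : 0 < ‖p‖) (hp1 : ‖p‖ < 1) {A b q Z K : ℂ} (hA : A ≠ 0)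
    (hb : b ≠ 0) (hq : q ≠ 0) (hZ : Z ≠ 0)
    (hK : ∀ u v : ℂ, u ≠ 0 → v ≠ 0 → ellTheta u p * ellTheta v p
        = K * (ellTheta (-(u * v)) (p ^ 2) * ellTheta (-(p * (u / v))) (p ^ 2)
          - v * (ellTheta (-(p * (u * v))) (p ^ 2) * ellTheta (-(u / v)) (p ^ 2)))) :
    (ellTheta (b * q ^ 3 * Z) (p ^ 2) * ellTheta (A ^ 2 * Z) (p ^ 2)
          * (ellTheta (-(A * b * q)) p * ellTheta (-(A * b * q ^ 2)) p)
        - b * q ^ 2 * (ellTheta (A ^ 2 * b ^ 2 * q ^ 4 * Z) (p ^ 2) * ellTheta (Z / (b * q)) (p ^ 2)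
          * (ellTheta (-(A / q)) p * ellTheta (-A) p))) * ellTheta (-(b * q ^ 2)) p
      = K * (ellTheta (b ^ 2 * q ^ 4) (p ^ 2) * ellTheta (A ^ 2 * b * q) (p ^ 2))
        * (ellTheta (-(p * q)) (p ^ 2) * ellTheta (-(p * (b * q ^ 2))) (p ^ 2)
            * (ellTheta (-(q * Z)) (p ^ 2) * ellTheta (-(A ^ 2 * b * q ^ 2 * Z)) (p ^ 2))
          + A * Z * (ellTheta (-q) (p ^ 2) * ellTheta (-(b * q ^ 2)) (p ^ 2)
            * (ellTheta (-(p * (q * Z))) (p ^ 2)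
              * ellTheta (-(p * (A ^ 2 * b * q ^ 2 * Z))) (p ^ 2)))) := by
  have hp : p ≠ 0 := norm_pos_iff.mp hp0
  have l1 := hK (-(A * b * q ^ 2)) (-(A * b * q)) (neg_ne_zero.mpr (by positivity))
      (neg_ne_zero.mpr (by positivity))
  have l2 := hK (-A) (-(A / q)) (neg_ne_zero.mpr (by positivity)) (neg_ne_zero.mpr (by positivity))
  rw [neg_mul_neg, neg_div_neg_eq, show A * b * q ^ 2 * (A * b * q) = A ^ 2 * b ^ 2 * q ^ 3 by ring,
    show A * b * q ^ 2 / (A * b * q) = q by field_simp] at l1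
  rw [neg_mul_neg, neg_div_neg_eq, show A * (A / q) = A ^ 2 / q by ring,
    show A / (A / q) = q by field_simp] at l2
  have w0 := ellTheta_weierstrass (norm_sq_pos hp0) (norm_sq_lt_one hp1) (a := A ^ 2 * b * q)
    (c := -(b * q ^ 2)) (X := -(q * Z)) (M := -(b * q ^ 2)) (by positivity) (neg_ne_zero.mpr
    (by positivity))
    (neg_ne_zero.mpr (by positivity)) (neg_ne_zero.mpr (by positivity))
  rw [show -(b * q ^ 2) * -(q * Z) = b * q ^ 3 * Z by ring,
    show A ^ 2 * b * q * -(q * Z) / -(b * q ^ 2) = A ^ 2 * Z by field_simp,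
    show A ^ 2 * b * q * -(b * q ^ 2) = -(A ^ 2 * b ^ 2 * q ^ 3) by ring,
    show -(b * q ^ 2) * -(b * q ^ 2) = b ^ 2 * q ^ 4 by ring,
    show -(A ^ 2 * b ^ 2 * q ^ 3) / -(b * q ^ 2) = A ^ 2 * b * q by field_simp,
    show A ^ 2 * b * q * -(q * Z) = -(A ^ 2 * b * q ^ 2 * Z) by ring,
    show -(q * Z) / -(b * q ^ 2) = Z / (b * q) by field_simp,
    show -(A ^ 2 * b ^ 2 * q ^ 3) * -(q * Z) = A ^ 2 * b ^ 2 * q ^ 4 * Z by ring,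
    show A ^ 2 * b * q / -(b * q ^ 2) = -(A ^ 2 / q) by field_simp] at w0
  have w1 := ellTheta_weierstrass (norm_sq_pos hp0) (norm_sq_lt_one hp1) (a := A ^ 2 * b * q)
    (c := -(b * q ^ 2 / p)) (X := -(p * (q * Z))) (M := -(p * (b * q ^ 2))) (by positivity)
    (neg_ne_zero.mpr (by positivity)) (neg_ne_zero.mpr (by positivity)) (neg_ne_zero.mpr
    (by positivity))
  rw [show -(b * q ^ 2 / p) * -(p * (q * Z)) = b * q ^ 3 * Z by field_simp,
    show A ^ 2 * b * q * -(p * (q * Z)) / -(b * q ^ 2 / p) = p ^ 2 * (A ^ 2 * Z) by field_simp,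
    show A ^ 2 * b * q * -(p * (b * q ^ 2)) = -(p * (A ^ 2 * b ^ 2 * q ^ 3)) by ring,
    show -(b * q ^ 2 / p) * -(p * (b * q ^ 2)) = b ^ 2 * q ^ 4 by field_simp,
    show -(p * (A ^ 2 * b ^ 2 * q ^ 3)) / -(b * q ^ 2 / p) = p ^ 2 * (A ^ 2 * b * q) by field_simp,
    show A ^ 2 * b * q * -(p * (q * Z)) = -(p * (A ^ 2 * b * q ^ 2 * Z)) by ring,
    show -(p * (q * Z)) / -(p * (b * q ^ 2)) = Z / (b * q) by field_simp,
    show -(p * (A ^ 2 * b ^ 2 * q ^ 3)) * -(p * (q * Z)) = p ^ 2 * (A ^ 2 * b ^ 2 * q ^ 4 * Z) by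
      ring,
    show A ^ 2 * b * q / -(b * q ^ 2 / p) = -(p * (A ^ 2 / q)) by field_simp,
    ellTheta_sq_mul hp0 hp1 (x := A ^ 2 * Z) (by positivity),
    ellTheta_sq_mul hp0 hp1 (x := A ^ 2 * b * q) (by positivity),
    ellTheta_sq_mul hp0 hp1 (x := A ^ 2 * b ^ 2 * q ^ 4 * Z) (by positivity),
    ellTheta_neg_div hp0 hp1 (x := b * q ^ 2) (by positivity)] at w1
  rw [mul_comm (ellTheta (-(A * b * q)) p), mul_comm (ellTheta (-(A / q)) p), l1, l2,
    ellTheta_split hp0 hp1 (-(b * q ^ 2)), mul_neg p (b * q ^ 2)]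
  have w1' : ellTheta (b * q ^ 3 * Z) (p ^ 2) * ellTheta (A ^ 2 * Z) (p ^ 2)
        * (ellTheta (-(p * (b * q ^ 2))) (p ^ 2)
          * ellTheta (-(p * (A ^ 2 * b ^ 2 * q ^ 3))) (p ^ 2))
      - ellTheta (A ^ 2 * b ^ 2 * q ^ 4 * Z) (p ^ 2) * ellTheta (Z / (b * q)) (p ^ 2)
        * (ellTheta (-(p * (b * q ^ 2))) (p ^ 2) * ellTheta (-(p * (A ^ 2 / q))) (p ^ 2))
      - Z / (b * q) * (ellTheta (b ^ 2 * q ^ 4) (p ^ 2) * ellTheta (A ^ 2 * b * q) (p ^ 2)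
        * (ellTheta (-(p * (q * Z))) (p ^ 2) * ellTheta (-(p * (A ^ 2 * b * q ^ 2 * Z))) (p ^ 2)))
      = 0 := by
    rw [← mul_zero (-(A ^ 2 * Z)), ← w1]
    field_simp
    ring
  have hAq : b * q ^ 2 * (A / q) = A * b * q := by field_simp
  have hbq : A * b * q * (Z / (b * q)) = A * Z := by field_simp
  linear_combination K * ellTheta (-(p * q)) (p ^ 2) * ellTheta (-(p * (b * q ^ 2))) (p ^ 2) * w0
    + K * A * b * q * ellTheta (-q) (p ^ 2) * ellTheta (-(b * q ^ 2)) (p ^ 2) * w1'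
    - K * (ellTheta (A ^ 2 * b ^ 2 * q ^ 4 * Z) (p ^ 2) * ellTheta (Z / (b * q)) (p ^ 2)
      * ellTheta (-(p * (A ^ 2 / q))) (p ^ 2) * ellTheta (-q) (p ^ 2)
      * (ellTheta (-(b * q ^ 2)) (p ^ 2) * ellTheta (-(p * (b * q ^ 2))) (p ^ 2))) * hAq
    + K * ellTheta (-q) (p ^ 2) * ellTheta (-(b * q ^ 2)) (p ^ 2)
      * (ellTheta (b ^ 2 * q ^ 4) (p ^ 2) * ellTheta (A ^ 2 * b * q) (p ^ 2)
        * (ellTheta (-(p * (q * Z))) (p ^ 2)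
          * ellTheta (-(p * (A ^ 2 * b * q ^ 2 * Z))) (p ^ 2))) * hbq

/-- The right bracket of the four-term relation, treated in the same way as the left one: multiplied
by `θ(-A q Z; p)` it becomes a multiple of the right side of `ellTheta_quartic`. -/
theorem ellTheta_bracket_right (hp0 : 0 < ‖p‖) (hp1 : ‖p‖ < 1) {A b q Z K : ℂ} (hA : A ≠ 0)
    (hb : b ≠ 0) (hq : q ≠ 0) (hZ : Z ≠ 0)
    (hK : ∀ u v : ℂ, u ≠ 0 → v ≠ 0 → ellTheta u p * ellTheta v p
        = K * (ellTheta (-(u * v)) (p ^ 2) * ellTheta (-(p * (u / v))) (p ^ 2)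
          - v * (ellTheta (-(p * (u * v))) (p ^ 2) * ellTheta (-(u / v)) (p ^ 2)))) :
    (ellTheta (A ^ 2 * b * q ^ 3 * Z) (p ^ 2) * ellTheta (q ^ 2 * Z) (p ^ 2)
          * (ellTheta (-(A * Z)) p * ellTheta (-(b * q ^ 2)) p)
        - b * q ^ 2 * (ellTheta (A ^ 2 * Z) (p ^ 2) * ellTheta (Z / (b * q)) (p ^ 2)
          * (ellTheta (-(A * b * q ^ 3 * Z)) p * ellTheta (-q) p))) * ellTheta (-(A * q * Z)) p
      = K * (ellTheta (A ^ 2 * q ^ 2 * Z ^ 2) (p ^ 2) * ellTheta (b * q ^ 3) (p ^ 2))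
        * (ellTheta (-(A * b * q ^ 2 * Z)) (p ^ 2) * ellTheta (-(A * q * Z)) (p ^ 2)
            * (ellTheta (-(p * (A / q))) (p ^ 2) * ellTheta (-(p * (A * b * q ^ 2))) (p ^ 2))
          + q * Z * (ellTheta (-(p * (A * b * q ^ 2 * Z))) (p ^ 2)
            * ellTheta (-(p * (A * q * Z))) (p ^ 2)
            * (ellTheta (-(A / q)) (p ^ 2) * ellTheta (-(A * b * q ^ 2)) (p ^ 2)))) := by
  have hp : p ≠ 0 := norm_pos_iff.mp hp0
  have hn2 := norm_sq_lt_one hp1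
  have l1 := hK (-(A * Z)) (-(b * q ^ 2)) (neg_ne_zero.mpr (by positivity)) (neg_ne_zero.mpr
      (by positivity))
  have l2 := hK (-(A * b * q ^ 3 * Z)) (-q) (neg_ne_zero.mpr (by positivity))
      (neg_ne_zero.mpr (by positivity))
  rw [neg_mul_neg, neg_div_neg_eq, show A * Z * (b * q ^ 2) = A * b * q ^ 2 * Z by ring] at l1
  rw [neg_mul_neg, neg_div_neg_eq, show A * b * q ^ 3 * Z * q = A * b * q ^ 4 * Z by ring,
    show A * b * q ^ 3 * Z / q = A * b * q ^ 2 * Z by field_simp] at l2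
  have w0 := ellTheta_weierstrass (norm_sq_pos hp0) hn2 (a := b * q ^ 3)
    (c := -(A * b * q ^ 4 * Z)) (X := -(A / q)) (M := -(A * Z / (b * q ^ 2))) (by positivity)
    (neg_ne_zero.mpr (by positivity)) (neg_ne_zero.mpr (by positivity)) (neg_ne_zero.mpr
    (by positivity))
  rw [show -(A * b * q ^ 4 * Z) * -(A / q) = A ^ 2 * b * q ^ 3 * Z by field_simp,
    show b * q ^ 3 * -(A / q) / -(A * b * q ^ 4 * Z) = (q ^ 2 * Z)⁻¹ by field_simp,
    show b * q ^ 3 * -(A * Z / (b * q ^ 2)) = -(A * q * Z) by field_simp,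
    show -(A * b * q ^ 4 * Z) * -(A * Z / (b * q ^ 2)) = A ^ 2 * q ^ 2 * Z ^ 2 by field_simp,
    show -(A * q * Z) / -(A * b * q ^ 4 * Z) = (b * q ^ 3)⁻¹ by field_simp,
    show b * q ^ 3 * -(A / q) = -(A * b * q ^ 2) by field_simp,
    show -(A / q) / -(A * Z / (b * q ^ 2)) = (Z / (b * q))⁻¹ by field_simp,
    show -(A * q * Z) * -(A / q) = A ^ 2 * Z by field_simp,
    show b * q ^ 3 / -(A * b * q ^ 4 * Z) = (-(A * q * Z))⁻¹ by field_simp,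
    ellTheta_inv hn2 (x := q ^ 2 * Z) (by positivity),
    ellTheta_inv hn2 (x := b * q ^ 3) (by positivity),
    ellTheta_inv hn2 (x := Z / (b * q)) (by positivity),
    ellTheta_inv hn2 (x := -(A * q * Z)) (neg_ne_zero.mpr (by positivity))] at w0
  have w1 := ellTheta_weierstrass (norm_sq_pos hp0) hn2 (a := b * q ^ 3)
    (c := -(A * b * q ^ 4 * Z / p)) (X := -(p * (A / q))) (M := -(p * (A * Z / (b * q ^ 2))))
    (by positivity) (neg_ne_zero.mpr (by positivity)) (neg_ne_zero.mpr
    (by positivity)) (neg_ne_zero.mpr (by positivity))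
  rw [show -(A * b * q ^ 4 * Z / p) * -(p * (A / q)) = A ^ 2 * b * q ^ 3 * Z by field_simp,
    show b * q ^ 3 * -(p * (A / q)) / -(A * b * q ^ 4 * Z / p) = p ^ 2 / (q ^ 2 * Z) by field_simp,
    show b * q ^ 3 * -(p * (A * Z / (b * q ^ 2))) = -(p * (A * q * Z)) by field_simp,
    show -(A * b * q ^ 4 * Z / p) * -(p * (A * Z / (b * q ^ 2))) = A ^ 2 * q ^ 2 * Z ^ 2 by
      field_simp,
    show -(p * (A * q * Z)) / -(A * b * q ^ 4 * Z / p) = p ^ 2 / (b * q ^ 3) by field_simp,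
    show b * q ^ 3 * -(p * (A / q)) = -(p * (A * b * q ^ 2)) by field_simp,
    show -(p * (A / q)) / -(p * (A * Z / (b * q ^ 2))) = (Z / (b * q))⁻¹ by field_simp,
    show -(p * (A * q * Z)) * -(p * (A / q)) = p ^ 2 * (A ^ 2 * Z) by field_simp,
    show b * q ^ 3 / -(A * b * q ^ 4 * Z / p) = p ^ 2 / -(p * (A * q * Z)) by field_simp,
    ellTheta_div_left (norm_sq_pos hp0) hn2, ellTheta_div_left (norm_sq_pos hp0) hn2,
    ellTheta_div_left (norm_sq_pos hp0) hn2,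
    ellTheta_inv hn2 (x := Z / (b * q)) (by positivity),
    ellTheta_sq_mul hp0 hp1 (x := A ^ 2 * Z) (by positivity),
    ellTheta_neg_div hp0 hp1 (x := A * b * q ^ 4 * Z) (by positivity)] at w1
  rw [l1, l2, ellTheta_split hp0 hp1 (-(A * q * Z)), mul_neg p (A * q * Z)]
  have w0' : ellTheta (A ^ 2 * b * q ^ 3 * Z) (p ^ 2) * ellTheta (q ^ 2 * Z) (p ^ 2)
        * (ellTheta (-(A * Z / (b * q ^ 2))) (p ^ 2) * ellTheta (-(A * q * Z)) (p ^ 2))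
      - ellTheta (A ^ 2 * Z) (p ^ 2) * ellTheta (Z / (b * q)) (p ^ 2)
        * (ellTheta (-(A * b * q ^ 4 * Z)) (p ^ 2) * ellTheta (-(A * q * Z)) (p ^ 2))
      - Z / (b * q) * (ellTheta (A ^ 2 * q ^ 2 * Z ^ 2) (p ^ 2) * ellTheta (b * q ^ 3) (p ^ 2)
        * (ellTheta (-(A / q)) (p ^ 2) * ellTheta (-(A * b * q ^ 2)) (p ^ 2)))
      = 0 := by
    rw [← mul_zero (-(q ^ 2 * Z)), ← w0]
    field_simp
    ring
  have w1' : ellTheta (A ^ 2 * b * q ^ 3 * Z) (p ^ 2) * ellTheta (q ^ 2 * Z) (p ^ 2)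
        * (ellTheta (-(p * (A * Z / (b * q ^ 2)))) (p ^ 2)
          * ellTheta (-(p * (A * q * Z))) (p ^ 2))
      - b * q ^ 3 * (ellTheta (A ^ 2 * Z) (p ^ 2) * ellTheta (Z / (b * q)) (p ^ 2)
        * (ellTheta (-(p * (A * b * q ^ 4 * Z))) (p ^ 2) * ellTheta (-(p * (A * q * Z))) (p ^ 2)))
      - ellTheta (A ^ 2 * q ^ 2 * Z ^ 2) (p ^ 2) * ellTheta (b * q ^ 3) (p ^ 2)
        * (ellTheta (-(p * (A / q))) (p ^ 2) * ellTheta (-(p * (A * b * q ^ 2))) (p ^ 2))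
      = 0 := by
    rw [← w1]
    field_simp
    ring
  have hbq : b * q ^ 2 * (Z / (b * q)) = q * Z := by field_simp
  linear_combination K * ellTheta (-(A * b * q ^ 2 * Z)) (p ^ 2)
      * ellTheta (-(A * q * Z)) (p ^ 2) * w1'
    + K * b * q ^ 2 * ellTheta (-(p * (A * b * q ^ 2 * Z))) (p ^ 2)
      * ellTheta (-(p * (A * q * Z))) (p ^ 2) * w0'
    + K * ellTheta (-(p * (A * b * q ^ 2 * Z))) (p ^ 2)
      * ellTheta (-(p * (A * q * Z))) (p ^ 2) * (ellTheta (A ^ 2 * q ^ 2 * Z ^ 2) (p ^ 2)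
      * ellTheta (b * q ^ 3) (p ^ 2)
        * (ellTheta (-(A / q)) (p ^ 2) * ellTheta (-(A * b * q ^ 2)) (p ^ 2))) * hbq

/-- The four-term theta relation that expresses the recurrence for the product side. The two
brackets are multiples of the two sides of `ellTheta_quartic`. -/
theorem ellTheta_four_term (hp0 : 0 < ‖p‖) (hp1 : ‖p‖ < 1) {A b q z : ℂ} (hA : A ≠ 0)
    (hb : b ≠ 0) (hq : q ≠ 0) (hz : z ≠ 0) (h1 : ellTheta (-(b * q ^ 2)) p ≠ 0)
    (h2 : ellTheta (-(A * q * z ^ 2)) p ≠ 0) :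
    ellTheta (A * q * z ^ 2) p * ellTheta (b * q ^ 3) (p ^ 2)
        * (ellTheta (b * q ^ 3 * z ^ 2) (p ^ 2) * ellTheta (A ^ 2 * z ^ 2) (p ^ 2)
          * (ellTheta (-(A * b * q)) p * ellTheta (-(A * b * q ^ 2)) p)
        - b * q ^ 2 * (ellTheta (A ^ 2 * b ^ 2 * q ^ 4 * z ^ 2) (p ^ 2)
          * ellTheta (z ^ 2 / (b * q)) (p ^ 2) * (ellTheta (-(A / q)) p * ellTheta (-A) p)))
      = ellTheta (b * q ^ 2) p * ellTheta (A ^ 2 * b * q) (p ^ 2)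
        * (ellTheta (A ^ 2 * b * q ^ 3 * z ^ 2) (p ^ 2) * ellTheta (q ^ 2 * z ^ 2) (p ^ 2)
          * (ellTheta (-(A * z ^ 2)) p * ellTheta (-(b * q ^ 2)) p)
        - b * q ^ 2 * (ellTheta (A ^ 2 * z ^ 2) (p ^ 2) * ellTheta (z ^ 2 / (b * q)) (p ^ 2)
          * (ellTheta (-(A * b * q ^ 3 * z ^ 2)) p * ellTheta (-q) p))) := by
  obtain ⟨K, -, hK⟩ := exists_landen hp0 hp1
  have hZ : z ^ 2 ≠ 0 := pow_ne_zero _ hz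
  have el := ellTheta_bracket_left hp0 hp1 hA hb hq hZ hK
  have er := ellTheta_bracket_right hp0 hp1 hA hb hq hZ hK
  have eg := ellTheta_quartic hp0 hp1 hA hb hq hz
  have s1 := ellTheta_sq hp1 (b * q ^ 2)
  have s2 := ellTheta_sq hp1 (A * q * z ^ 2)
  rw [show (b * q ^ 2) ^ 2 = b ^ 2 * q ^ 4 by ring] at s1
  rw [show (A * q * z ^ 2) ^ 2 = A ^ 2 * q ^ 2 * (z ^ 2) ^ 2 by ring] at s2
  rw [eg, s1] at el
  rw [s2] at er
  refine mul_right_cancel₀ (mul_ne_zero h1 h2) ?_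
  linear_combination ellTheta (A * q * z ^ 2) p * ellTheta (b * q ^ 3) (p ^ 2)
      * ellTheta (-(A * q * z ^ 2)) p * el
    - ellTheta (b * q ^ 2) p * ellTheta (A ^ 2 * b * q) (p ^ 2) * ellTheta (-(b * q ^ 2)) p * er

end Identities

/-! ### Contiguous summands -/

section Contiguous

variable {p : ℂ}

theorem ellFac_zero (x q : ℂ) : ellFac x q p 0 = 1 := by simp [ellFac]

theorem ellFac_succ (x q : ℂ) (k : ℕ) :
    ellFac x q p (k + 1) = ellFac x q p k * ellTheta (x * q ^ k) p :=
  Finset.prod_range_succ _ _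

theorem ellFac_succ_left (x q : ℂ) (k : ℕ) :
    ellFac x q p (k + 1) = ellTheta x p * ellFac (x * q) q p k := by
  rw [ellFac, Finset.prod_range_succ', mul_comm, ellFac]
  congr 1
  · simp
  · exact Finset.prod_congr rfl fun j _ => by rw [pow_succ']; ring_nf

theorem ellFac_mul_ellTheta (x q : ℂ) (k : ℕ) :
    ellFac (x * q) q p k * ellTheta x p = ellFac x q p k * ellTheta (x * q ^ k) p := by
  rw [mul_comm, ← ellFac_succ_left, ellFac_succ]

/-- The summand of the quadratic summation, in terms of `A = a / b` and `z = qⁿ`. -/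
noncomputable def quadSummand (A b q p z : ℂ) (k : ℕ) : ℂ :=
  ellTheta (A ^ 2 * b ^ 2 * q ^ (4 * k)) (p ^ 2) / ellTheta (A ^ 2 * b ^ 2) (p ^ 2)
    * ((ellFac (A ^ 2 * b ^ 2) (q ^ 2) (p ^ 2) k * ellFac (b / q) (q ^ 2) (p ^ 2) k)
      / (ellFac (q ^ 2) (q ^ 2) (p ^ 2) k * ellFac (A ^ 2 * b * q ^ 3) (q ^ 2) (p ^ 2) k))
    * ((ellFac (A * z) q p k * ellFac z⁻¹ q p k)
      / (ellFac (b * q / z) q p k * ellFac (A * b * q * z) q p k))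
    * q ^ (2 * k)

/-- The common factor of the four contiguous summands with parameters `(n + 2; a, b q²)`,
`(n + 1; a q², b q²)`, `(n + 1; a, b)` and `(n; a, b)`, where `z = qⁿ` and `a = A b`. -/
noncomputable def quadCommon (A b q p z : ℂ) (k : ℕ) : ℂ :=
  ellTheta (A ^ 2 * b ^ 2 * q ^ (4 * k)) (p ^ 2) / ellTheta (A ^ 2 * b ^ 2) (p ^ 2)
    * ((ellFac (A ^ 2 * b ^ 2) (q ^ 2) (p ^ 2) k * ellFac (b / q) (q ^ 2) (p ^ 2) k)
      / (ellFac (q ^ 2) (q ^ 2) (p ^ 2) k * ellFac (A ^ 2 * b * q ^ 3) (q ^ 2) (p ^ 2) k))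
    * ((ellFac (A * z) q p k * ellFac (z * q ^ 2)⁻¹ q p k)
      / (ellFac (b * q / z) q p k * ellFac (A * b * q ^ 3 * z) q p k))
    * q ^ (2 * k)

variable {A b q z : ℂ}

/-- The summand with parameters `(n + 2; a, b q²)`. -/
theorem quadSummand_shift_b (hq : q ≠ 0) (hz : z ≠ 0) (k : ℕ)
    (h1 : ellTheta (b / q) (p ^ 2) ≠ 0)
    (h2 : ellTheta (A ^ 2 * b * q * (q ^ 2) ^ k) (p ^ 2) ≠ 0)
    (h3 : ellTheta (A ^ 2 * b * q) (p ^ 2) ≠ 0) :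
    ellTheta (b / q) (p ^ 2) * ellTheta (A ^ 2 * b * q) (p ^ 2)
        * quadSummand (A / q ^ 2) (b * q ^ 2) q p (z * q ^ 2) k
      = quadCommon A b q p z k * (ellTheta (b / q * (q ^ 2) ^ k) (p ^ 2)
        * ellTheta (A ^ 2 * b * q * (q ^ 2) ^ k) (p ^ 2)) := by
  have s1 := ellFac_mul_ellTheta (p := p ^ 2) (b / q) (q ^ 2) k
  have s2 := ellFac_mul_ellTheta (p := p ^ 2) (A ^ 2 * b * q) (q ^ 2) k
  rw [← eq_div_iff h1] at s1
  rw [← div_eq_iff h2] at s2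
  rw [quadSummand, quadCommon, show (A / q ^ 2) ^ 2 * (b * q ^ 2) ^ 2 = A ^ 2 * b ^ 2 by field_simp,
    show b * q ^ 2 / q = b / q * q ^ 2 by ring,
    show (A / q ^ 2) ^ 2 * (b * q ^ 2) * q ^ 3 = A ^ 2 * b * q by field_simp,
    show A / q ^ 2 * (z * q ^ 2) = A * z by field_simp,
    show b * q ^ 2 * q / (z * q ^ 2) = b * q / z by field_simp,
    show A / q ^ 2 * (b * q ^ 2) * q * (z * q ^ 2) = A * b * q ^ 3 * z by field_simp,
    s1, ← s2, show A ^ 2 * b * q * q ^ 2 = A ^ 2 * b * q ^ 3 by ring]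
  have alg : ∀ W W₀ P B BX t Q F AX G N C : ℂ, t ≠ 0 → G ≠ 0 → AX ≠ 0 →
      t * G * (W / W₀ * ((P * (B * BX / t)) / (Q * (F * G / AX))) * N * C)
        = W / W₀ * ((P * B) / (Q * F)) * N * C * (BX * AX) := by
    intros; field_simp
  exact alg _ _ _ _ _ _ _ _ _ _ _ _ h1 h3 h2

/-- The summand with parameters `(n + 1; a q², b q²)`; here the index is shifted by one, because
replacing `a` by `a q²` moves the very-well-poised factor `θ(a² q^{4k}; p²)` from `k` to `k + 1`. -/
theorem quadSummand_shift_ab (hq : q ≠ 0) (hz : z ≠ 0) (j : ℕ)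
    (h1 : ellTheta (A ^ 2 * b ^ 2) (p ^ 2) ≠ 0)
    (h2 : ellTheta (A ^ 2 * b ^ 2 * q ^ 2) (p ^ 2) ≠ 0)
    (h3 : ellTheta (A ^ 2 * b ^ 2 * q ^ 4) (p ^ 2) ≠ 0)
    (h5 : ellTheta (A ^ 2 * b * q ^ 3) (p ^ 2) ≠ 0)
    (h8 : ellTheta (b * q / z) p ≠ 0) (h9 : ellTheta (A * b * q ^ 3 * z) p ≠ 0)
    (h10 : ellTheta ((q ^ 2) ^ (j + 1)) (p ^ 2) ≠ 0) :
    q ^ 2 * (ellTheta (A ^ 2 * b ^ 2 * q ^ 2) (p ^ 2) * ellTheta (A ^ 2 * b ^ 2 * q ^ 4) (p ^ 2)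
        * ellTheta (b / q) (p ^ 2) * ellTheta (A * z) p * ellTheta (z * q ^ 2)⁻¹ p)
        * quadSummand A (b * q ^ 2) q p (z * q) j
      = quadCommon A b q p z (j + 1) * (ellTheta ((q ^ 2) ^ (j + 1)) (p ^ 2)
        * ellTheta (A ^ 2 * b ^ 2 * (q ^ 2) ^ (j + 1)) (p ^ 2))
        * (ellTheta (A ^ 2 * b * q ^ 3) (p ^ 2) * ellTheta (b * q / z) p
          * ellTheta (A * b * q ^ 3 * z) p) := by
  have s1 := ellFac_succ_left (p := p ^ 2) (A ^ 2 * b ^ 2) (q ^ 2) (j + 1)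
  rw [ellFac_succ, ellFac_succ_left (A ^ 2 * b ^ 2 * q ^ 2),
    show A ^ 2 * b ^ 2 * q ^ 2 * q ^ 2 = A ^ 2 * b ^ 2 * q ^ 4 by ring] at s1
  have s2 := ellFac_succ_left (p := p ^ 2) (b / q) (q ^ 2) j
  have s3 := ellFac_succ (p := p ^ 2) (q ^ 2) (q ^ 2) j
  have s4 := ellFac_succ_left (p := p ^ 2) (A ^ 2 * b * q ^ 3) (q ^ 2) j
  have s5 := ellFac_succ_left (p := p) (A * z) q j
  have s6 := ellFac_succ_left (p := p) (z * q ^ 2)⁻¹ q j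
  have s7 := ellFac_succ_left (p := p) (b * q / z) q j
  have s8 := ellFac_succ_left (p := p) (A * b * q ^ 3 * z) q j
  rw [← pow_succ'] at s3
  rw [quadSummand, quadCommon, s2, s3, s4, s5, s6, s7, s8,
    show A ^ 2 * (b * q ^ 2) ^ 2 * q ^ (4 * j) = A ^ 2 * b ^ 2 * q ^ (4 * (j + 1)) by ring,
    show A ^ 2 * (b * q ^ 2) ^ 2 = A ^ 2 * b ^ 2 * q ^ 4 by ring,
    show b * q ^ 2 / q = b / q * q ^ 2 by ring,
    show A ^ 2 * (b * q ^ 2) * q ^ 3 = A ^ 2 * b * q ^ 3 * q ^ 2 by ring,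
    show A * (z * q) = A * z * q by ring,
    show (z * q)⁻¹ = (z * q ^ 2)⁻¹ * q by field_simp,
    show b * q ^ 2 * q / (z * q) = b * q / z * q by field_simp,
    show A * (b * q ^ 2) * q * (z * q) = A * b * q ^ 3 * z * q by ring,
    show q ^ (2 * (j + 1)) = q ^ (2 * j) * q ^ 2 by ring]
  have s1' : ellFac (A ^ 2 * b ^ 2 * q ^ 4) (q ^ 2) (p ^ 2) j
      = ellFac (A ^ 2 * b ^ 2) (q ^ 2) (p ^ 2) (j + 1)
        * ellTheta (A ^ 2 * b ^ 2 * (q ^ 2) ^ (j + 1)) (p ^ 2)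
        / (ellTheta (A ^ 2 * b ^ 2) (p ^ 2) * ellTheta (A ^ 2 * b ^ 2 * q ^ 2) (p ^ 2)) := by
    rw [eq_div_iff (mul_ne_zero h1 h2), s1]; ring
  rw [s1']
  have alg : ∀ W Q P PX t₀ t₂ t₄ tb B Qj QX F tF N tN M tM D tD E tE C : ℂ, t₂ ≠ 0 →
      t₄ ≠ 0 → QX ≠ 0 → tF ≠ 0 → tD ≠ 0 → tE ≠ 0 →
      Q * (t₂ * t₄ * tb * tN * tM)
          * (W / t₄ * ((P * PX / (t₀ * t₂) * B) / (Qj * F)) * ((N * M) / (D * E)) * C)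
        = W / t₀ * ((P * (tb * B)) / ((Qj * QX) * (tF * F)))
          * (((tN * N) * (tM * M)) / ((tD * D) * (tE * E))) * (C * Q) * (QX * PX)
          * (tF * tD * tE) := by
    intro W Q P PX t₀ t₂ t₄ tb B Qj QX F tF N tN M tM D tD E tE C h₂ h₄ hQ hF hD hE
    have e₂ := mul_inv_cancel₀ h₂
    have e₄ := mul_inv_cancel₀ h₄
    have eQ := mul_inv_cancel₀ hQ
    have eF := mul_inv_cancel₀ hF
    have eD := mul_inv_cancel₀ hD
    have eE := mul_inv_cancel₀ hE
    simp only [div_eq_mul_inv, mul_inv]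
    generalize t₀⁻¹ = i₀, t₂⁻¹ = i₂, t₄⁻¹ = i₄, QX⁻¹ = iX, tF⁻¹ = iF, tD⁻¹ = iD, tE⁻¹ = iE,
      Qj⁻¹ = Qi, F⁻¹ = Fi, D⁻¹ = Di, E⁻¹ = Ei at *
    trans Q * tb * tN * tM * W * P * PX * i₀ * B * Qi * Fi * N * M * Di * Ei * C
    · trans Q * tb * tN * tM * W * P * PX * i₀ * B * Qi * Fi * N * M * Di * Ei * C
        * (t₂ * i₂) * (t₄ * i₄)
      · ring
      · rw [e₂, e₄, mul_one, mul_one]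
    · trans Q * tb * tN * tM * W * P * PX * i₀ * B * Qi * Fi * N * M * Di * Ei * C
        * (QX * iX) * (tF * iF) * (tD * iD) * (tE * iE)
      · rw [eQ, eF, eD, eE, mul_one, mul_one, mul_one, mul_one]
      · ring
  exact alg _ _ _ _ _ _ _ _ _ _ _ _ _ _ _ _ _ _ _ _ _ _ h2 h3 h10 h5 h8 h9

/-- The summand with parameters `(n + 1; a, b)`. -/
theorem quadSummand_shift_n (hq : q ≠ 0) (hz : z ≠ 0) (k : ℕ)
    (h1 : ellTheta (A * z) p ≠ 0) (h2 : ellTheta (b / z) p ≠ 0)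
    (h3 : ellTheta (b / z * q ^ k) p ≠ 0) (h4 : ellTheta (z * q ^ 2)⁻¹ p ≠ 0)
    (h5 : ellTheta (A * b * q ^ 2 * z) p ≠ 0)
    (h6 : ellTheta (A * b * q ^ 2 * z * q ^ k) p ≠ 0) :
    ellTheta (A * z) p * ellTheta (b / z) p * ellTheta (z * q ^ 2)⁻¹ p
        * ellTheta (A * b * q ^ 2 * z) p * quadSummand A b q p (z * q) k
      = quadCommon A b q p z k * (ellTheta ((z * q ^ 2)⁻¹ * q ^ k) p
        * ellTheta (A * b * q ^ 2 * z * q ^ k) p)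
        * (ellTheta (b / z * q ^ k) p * ellTheta (A * z * q ^ k) p) := by
  have s1 := ellFac_mul_ellTheta (p := p) (A * z) q k
  have s2 := ellFac_mul_ellTheta (p := p) (z * q ^ 2)⁻¹ q k
  have s3 := ellFac_mul_ellTheta (p := p) (b / z) q k
  have s4 := ellFac_mul_ellTheta (p := p) (A * b * q ^ 2 * z) q k
  rw [← eq_div_iff h1] at s1
  rw [← eq_div_iff h4] at s2
  rw [← div_eq_iff h3] at s3
  rw [← div_eq_iff h6] at s4
  rw [quadSummand, quadCommon, show A * (z * q) = A * z * q by ring,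
    show (z * q)⁻¹ = (z * q ^ 2)⁻¹ * q by field_simp,
    show b * q / (z * q) = b / z by field_simp,
    show A * b * q * (z * q) = A * b * q ^ 2 * z by ring, s1, s2, ← s3, ← s4,
    show b / z * q = b * q / z by ring,
    show A * b * q ^ 2 * z * q = A * b * q ^ 3 * z by ring]
  have alg : ∀ V N tN NX M tM MX D tD DX E tE EX C : ℂ, tN ≠ 0 → tM ≠ 0 → tD ≠ 0 → tE ≠ 0 →
      DX ≠ 0 → EX ≠ 0 →
      tN * tD * tM * tE * (V * ((N * NX / tN * (M * MX / tM)) / ((D * tD / DX) * (E * tE / EX)))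
          * C)
        = V * ((N * M) / (D * E)) * C * (MX * EX) * (DX * NX) := by
    intros; field_simp
  exact alg _ _ _ _ _ _ _ _ _ _ _ _ _ _ h1 h4 h2 h5 h3 h6

/-- The summand with parameters `(n; a, b)`. -/
theorem quadSummand_eq_common (hq : q ≠ 0) (hz : z ≠ 0) (k : ℕ)
    (h1 : ellTheta (z * q ^ 2)⁻¹ p ≠ 0) (h2 : ellTheta (z * q)⁻¹ p ≠ 0)
    (h3 : ellTheta (A * b * q * z) p ≠ 0) (h4 : ellTheta (A * b * q ^ 2 * z) p ≠ 0)
    (h5 : ellTheta (A * b * q * z * q ^ k) p ≠ 0)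
    (h6 : ellTheta (A * b * q ^ 2 * z * q ^ k) p ≠ 0) :
    ellTheta (z * q ^ 2)⁻¹ p * ellTheta (z * q)⁻¹ p * ellTheta (A * b * q * z) p
        * ellTheta (A * b * q ^ 2 * z) p * quadSummand A b q p z k
      = quadCommon A b q p z k * (ellTheta ((z * q ^ 2)⁻¹ * q ^ k) p
        * ellTheta (A * b * q ^ 2 * z * q ^ k) p)
        * (ellTheta ((z * q)⁻¹ * q ^ k) p * ellTheta (A * b * q * z * q ^ k) p) := by
  have s1 := ellFac_mul_ellTheta (p := p) (z * q ^ 2)⁻¹ q k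
  have s2 := ellFac_mul_ellTheta (p := p) (z * q)⁻¹ q k
  have s3 := ellFac_mul_ellTheta (p := p) (A * b * q * z) q k
  have s4 := ellFac_mul_ellTheta (p := p) (A * b * q ^ 2 * z) q k
  rw [show (z * q ^ 2)⁻¹ * q = (z * q)⁻¹ by field_simp, ← eq_div_iff h1] at s1
  rw [show (z * q)⁻¹ * q = z⁻¹ by field_simp, ← eq_div_iff h2, s1] at s2
  rw [← div_eq_iff h5] at s3
  rw [← div_eq_iff h6] at s4
  rw [quadSummand, quadCommon, s2, ← s3, show A * b * q * z * q = A * b * q ^ 2 * z by ring, ← s4,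
    show A * b * q ^ 2 * z * q = A * b * q ^ 3 * z by ring]
  have alg : ∀ V N M t₂ M₂ t₁ M₁ D E tE EX tF FX C : ℂ, t₂ ≠ 0 → t₁ ≠ 0 → tE ≠ 0 → EX ≠ 0 →
      tF ≠ 0 → FX ≠ 0 →
      t₂ * t₁ * tF * tE * (V * ((N * (M * M₂ / t₂ * M₁ / t₁)) / (D * (E * tE / EX * tF / FX))) * C)
        = V * ((N * M) / (D * E)) * C * (M₂ * EX) * (M₁ * FX) := by
    intros; field_simp
  exact alg _ _ _ _ _ _ _ _ _ _ _ _ _ _ h1 h2 h4 h6 h3 h5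

end Contiguous

/-! ### The four-term relation for the summands -/

section Relation

/-- The factor `θ(a² q³ / b; p²) θ(b q / z; p) θ(a q³ z; p)` (with `a = A b`) by which the
coefficients of the four-term relation have been cleared of denominators. -/
noncomputable def quadClear (A b q p z : ℂ) : ℂ :=
  ellTheta (A ^ 2 * b * q ^ 3) (p ^ 2) * ellTheta (b * q / z) p * ellTheta (A * b * q ^ 3 * z) p

/-- Coefficient of the summand with parameters `(n + 2; a, b q²)`. -/
noncomputable def quadCoeff₁ (A b q p z : ℂ) : ℂ :=
  q * ellTheta (b * q) p * ellTheta (A * q * z ^ 2) p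
    * (ellTheta (q ^ 4 * z ^ 2) (p ^ 2) * ellTheta (A ^ 2 * b ^ 2 * q ^ 4 * z ^ 2) (p ^ 2))
    * (ellTheta (b / q) (p ^ 2) * ellTheta (A ^ 2 * b * q) (p ^ 2)) * quadClear A b q p z

/-- Coefficient of the summand with parameters `(n + 1; a q², b q²)`. -/
noncomputable def quadCoeff₂ (A b q p z : ℂ) : ℂ :=
  -(q * ellTheta (b * q) p * ellTheta (A * q * z ^ 2) p
    * (ellTheta (b * q ^ 3 * z ^ 2) (p ^ 2) * ellTheta (A ^ 2 * b * q ^ 5 * z ^ 2) (p ^ 2)))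
    * (q ^ 2 * (ellTheta (A ^ 2 * b ^ 2 * q ^ 2) (p ^ 2)
      * ellTheta (A ^ 2 * b ^ 2 * q ^ 4) (p ^ 2)
      * ellTheta (b / q) (p ^ 2) * ellTheta (A * z) p * ellTheta (z * q ^ 2)⁻¹ p))

/-- Coefficient of the summand with parameters `(n + 1; a, b)`. -/
noncomputable def quadCoeff₃ (A b q p z : ℂ) : ℂ :=
  q ^ 4 * z ^ 2 * (ellTheta (b / q) (p ^ 2) * ellTheta (A ^ 2 * b * q) (p ^ 2))
    * (ellTheta (-q) p * ellTheta (-(A * b * q ^ 3 * z ^ 2)) p) * quadClear A b q p z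
    * (ellTheta (A * z) p * ellTheta (b / z) p * ellTheta (z * q ^ 2)⁻¹ p
        * ellTheta (A * b * q ^ 2 * z) p)

/-- Coefficient of the summand with parameters `(n; a, b)`. -/
noncomputable def quadCoeff₄ (A b q p z : ℂ) : ℂ :=
  -(q ^ 4 * z ^ 2 * (ellTheta (b / q) (p ^ 2) * ellTheta (A ^ 2 * b * q) (p ^ 2))
    * (ellTheta (-(b * q ^ 2)) p * ellTheta (-(A * q ^ 2 * z ^ 2)) p) * quadClear A b q p z)
    * (ellTheta (z * q ^ 2)⁻¹ p * ellTheta (z * q)⁻¹ p * ellTheta (A * b * q * z) p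
        * ellTheta (A * b * q ^ 2 * z) p)

variable {p A b q z : ℂ}

/-- The relation between the theta factors by which the four contiguous summands differ: an
instance of Weierstrass' formula in nome `p²` followed by one in nome `p`. -/
theorem quadCoeff_relation (hp0 : 0 < ‖p‖) (hp1 : ‖p‖ < 1) (hA : A ≠ 0) (hb : b ≠ 0) (hq : q ≠ 0)
    (hz : z ≠ 0) (k : ℕ) {V T₁ T₂ T₃ T₄ : ℂ}
    (h₁ : ellTheta (b / q) (p ^ 2) * ellTheta (A ^ 2 * b * q) (p ^ 2) * T₁
      = V * (ellTheta (b / q * (q ^ 2) ^ k) (p ^ 2)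
        * ellTheta (A ^ 2 * b * q * (q ^ 2) ^ k) (p ^ 2)))
    (h₂ : q ^ 2 * (ellTheta (A ^ 2 * b ^ 2 * q ^ 2) (p ^ 2)
        * ellTheta (A ^ 2 * b ^ 2 * q ^ 4) (p ^ 2)
        * ellTheta (b / q) (p ^ 2) * ellTheta (A * z) p * ellTheta (z * q ^ 2)⁻¹ p) * T₂
      = V * (ellTheta ((q ^ 2) ^ k) (p ^ 2) * ellTheta (A ^ 2 * b ^ 2 * (q ^ 2) ^ k) (p ^ 2))
        * (ellTheta (A ^ 2 * b * q ^ 3) (p ^ 2) * ellTheta (b * q / z) p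
          * ellTheta (A * b * q ^ 3 * z) p))
    (h₃ : ellTheta (A * z) p * ellTheta (b / z) p * ellTheta (z * q ^ 2)⁻¹ p
        * ellTheta (A * b * q ^ 2 * z) p * T₃
      = V * (ellTheta ((z * q ^ 2)⁻¹ * q ^ k) p * ellTheta (A * b * q ^ 2 * z * q ^ k) p)
        * (ellTheta (b / z * q ^ k) p * ellTheta (A * z * q ^ k) p))
    (h₄ : ellTheta (z * q ^ 2)⁻¹ p * ellTheta (z * q)⁻¹ p * ellTheta (A * b * q * z) p
        * ellTheta (A * b * q ^ 2 * z) p * T₄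
      = V * (ellTheta ((z * q ^ 2)⁻¹ * q ^ k) p * ellTheta (A * b * q ^ 2 * z * q ^ k) p)
        * (ellTheta ((z * q)⁻¹ * q ^ k) p * ellTheta (A * b * q * z * q ^ k) p)) :
    quadCoeff₁ A b q p z * T₁ + quadCoeff₂ A b q p z * T₂ + quadCoeff₃ A b q p z * T₃
      + quadCoeff₄ A b q p z * T₄ = 0 := by
  have w1 := ellTheta_weierstrass (norm_sq_pos hp0) (norm_sq_lt_one hp1) (a := A ^ 2 * b ^ 2)
    (c := b / q) (X := (q ^ 2) ^ k) (M := q ^ 4 * z ^ 2) (by positivity) (by positivity)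
    (by positivity) (by positivity)
  rw [show A ^ 2 * b ^ 2 * (q ^ 2) ^ k / (b / q) = A ^ 2 * b * q * (q ^ 2) ^ k by field_simp,
    show A ^ 2 * b ^ 2 * (q ^ 4 * z ^ 2) = A ^ 2 * b ^ 2 * q ^ 4 * z ^ 2 by ring,
    show b / q * (q ^ 4 * z ^ 2) = b * q ^ 3 * z ^ 2 by field_simp,
    show A ^ 2 * b ^ 2 * q ^ 4 * z ^ 2 / (b / q) = A ^ 2 * b * q ^ 5 * z ^ 2 by field_simp,
    show (q ^ 2) ^ k / (q ^ 4 * z ^ 2) = ((z * q ^ 2)⁻¹ * q ^ k) ^ 2 by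
      rw [← pow_mul, mul_comm 2 k, pow_mul]; field_simp,
    show A ^ 2 * b ^ 2 * q ^ 4 * z ^ 2 * (q ^ 2) ^ k = (A * b * q ^ 2 * z * q ^ k) ^ 2 by
      rw [← pow_mul, mul_comm 2 k, pow_mul]; ring,
    show A ^ 2 * b ^ 2 / (b / q) = A ^ 2 * b * q by field_simp, ellTheta_sq hp1,
    ellTheta_sq hp1] at w1
  have w2 := ellTheta_weierstrass hp0 hp1 (a := A * b * q ^ 2 * z ^ 2) (c := b * q)
    (X := (z * q)⁻¹ * q ^ k) (M := -q) (by positivity) (by positivity)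
    (by positivity) (neg_ne_zero.mpr hq)
  rw [show b * q * ((z * q)⁻¹ * q ^ k) = b / z * q ^ k by field_simp,
    show A * b * q ^ 2 * z ^ 2 * ((z * q)⁻¹ * q ^ k) / (b * q) = A * z * q ^ k by field_simp,
    show A * b * q ^ 2 * z ^ 2 * -q = -(A * b * q ^ 3 * z ^ 2) by ring,
    show b * q * -q = -(b * q ^ 2) by ring,
    show -(A * b * q ^ 3 * z ^ 2) / (b * q) = -(A * q ^ 2 * z ^ 2) by field_simp,
    show A * b * q ^ 2 * z ^ 2 * ((z * q)⁻¹ * q ^ k) = A * b * q * z * q ^ k by field_simp,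
    show (z * q)⁻¹ * q ^ k / -q = -((z * q ^ 2)⁻¹ * q ^ k) by field_simp,
    show -(A * b * q ^ 3 * z ^ 2) * ((z * q)⁻¹ * q ^ k) = -(A * b * q ^ 2 * z * q ^ k) by
      field_simp,
    show A * b * q ^ 2 * z ^ 2 / (b * q) = A * q * z ^ 2 by field_simp] at w2
  unfold quadCoeff₁ quadCoeff₂ quadCoeff₃ quadCoeff₄ quadClear
  set C := ellTheta (A ^ 2 * b * q ^ 3) (p ^ 2) * ellTheta (b * q / z) p
    * ellTheta (A * b * q ^ 3 * z) p
  linear_combination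
    q * ellTheta (b * q) p * ellTheta (A * q * z ^ 2) p
      * (ellTheta (q ^ 4 * z ^ 2) (p ^ 2) * ellTheta (A ^ 2 * b ^ 2 * q ^ 4 * z ^ 2) (p ^ 2))
      * C * h₁
    - (q * ellTheta (b * q) p * ellTheta (A * q * z ^ 2) p
      * (ellTheta (b * q ^ 3 * z ^ 2) (p ^ 2)
        * ellTheta (A ^ 2 * b * q ^ 5 * z ^ 2) (p ^ 2))) * h₂
    + q ^ 4 * z ^ 2 * (ellTheta (b / q) (p ^ 2) * ellTheta (A ^ 2 * b * q) (p ^ 2)) * C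
      * (ellTheta (-q) p * ellTheta (-(A * b * q ^ 3 * z ^ 2)) p * h₃
        - ellTheta (-(b * q ^ 2)) p * ellTheta (-(A * q ^ 2 * z ^ 2)) p * h₄)
    + V * C * (q * ellTheta (b * q) p * ellTheta (A * q * z ^ 2) p * w1
      + q ^ 4 * z ^ 2 * (ellTheta (b / q) (p ^ 2) * ellTheta (A ^ 2 * b * q) (p ^ 2))
        * (ellTheta ((z * q ^ 2)⁻¹ * q ^ k) p * ellTheta (A * b * q ^ 2 * z * q ^ k) p) * w2)

/-! ### The four-term relation for the product side -/

/-- The closed form of the quadratic summation, in terms of `A = a / b`. -/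
noncomputable def quadProduct (A b q p : ℂ) (n : ℕ) : ℂ :=
  ellTheta (-(A * q ^ (2 * n))) p / ellTheta (-A) p
    * ((ellFac (-A) q p n * ellFac (A * b * q) q p n)
      / (ellFac (-q) q p n * ellFac b⁻¹ q p n))
    * (ellFac (b * q)⁻¹ (q ^ 2) (p ^ 2) n / ellFac (A ^ 2 * b * q ^ 3) (q ^ 2) (p ^ 2) n)
    * q ^ n

/-- The product of shifted factorials common to the four contiguous closed forms. -/
noncomputable def quadProductBase (A b q p : ℂ) (n : ℕ) : ℂ :=
  (ellFac (-A) q p n * ellFac (A * b * q) q p n) / (ellFac (-q) q p n * ellFac b⁻¹ q p n)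
    * (ellFac (b * q)⁻¹ (q ^ 2) (p ^ 2) n / ellFac (A ^ 2 * b * q ^ 3) (q ^ 2) (p ^ 2) n)

/-- The closed form with parameters `(n; a, b)`. -/
theorem quadProduct_eq_base (n : ℕ) :
    quadProduct A b q p n
      = ellTheta (-(A * (q ^ n) ^ 2)) p / ellTheta (-A) p * quadProductBase A b q p n * q ^ n := by
  rw [quadProduct, quadProductBase, ← pow_mul, mul_comm n 2]; ring

/-- The closed form with parameters `(n + 1; a, b)`. -/
theorem quadProduct_shift_n (n : ℕ) :
    quadProduct A b q p (n + 1)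
      = ellTheta (-(A * q ^ 2 * (q ^ n) ^ 2)) p / ellTheta (-A) p * quadProductBase A b q p n
        * ((ellTheta (-(A * q ^ n)) p * ellTheta (A * b * q * q ^ n) p)
          / (ellTheta (-(q * q ^ n)) p * ellTheta (b⁻¹ * q ^ n) p))
        * (ellTheta ((b * q)⁻¹ * (q ^ n) ^ 2) (p ^ 2)
          / ellTheta (A ^ 2 * b * q ^ 3 * (q ^ n) ^ 2) (p ^ 2)) * (q ^ n * q) := by
  have e : (q ^ 2) ^ n = (q ^ n) ^ 2 := by rw [← pow_mul, mul_comm 2 n, pow_mul]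
  rw [quadProduct, quadProductBase, ellFac_succ, ellFac_succ, ellFac_succ, ellFac_succ, ellFac_succ,
    ellFac_succ, e, neg_mul, neg_mul, show A * q ^ (2 * (n + 1)) = A * q ^ 2 * (q ^ n) ^ 2 by ring,
    pow_succ]
  simp only [div_eq_mul_inv, mul_inv]
  ring

/-- The closed form with parameters `(n + 1; a q², b q²)`. -/
theorem quadProduct_shift_ab (hq : q ≠ 0) (n : ℕ)
    (h1 : ellTheta (A * b * q) p ≠ 0) (h2 : ellTheta (A * b * q ^ 2) p ≠ 0)
    (h3 : ellTheta (b⁻¹ * q ^ n / q) p ≠ 0) (h4 : ellTheta (A ^ 2 * b * q ^ 3) (p ^ 2) ≠ 0) :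
    quadProduct A (b * q ^ 2) q p (n + 1)
      = ellTheta (-(A * q ^ 2 * (q ^ n) ^ 2)) p / ellTheta (-A) p * quadProductBase A b q p n
        * ((ellTheta (-(A * q ^ n)) p
            * (ellTheta (A * b * q * q ^ n) p * ellTheta (A * b * q ^ 2 * q ^ n) p
              * ellTheta (A * b * q ^ 3 * q ^ n) p
              / (ellTheta (A * b * q) p * ellTheta (A * b * q ^ 2) p)))
          / (ellTheta (-(q * q ^ n)) p * (ellTheta (b * q ^ 2)⁻¹ p * ellTheta (b * q)⁻¹ p
            / ellTheta (b⁻¹ * q ^ n / q) p)))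
        * (ellTheta (b * q ^ 3)⁻¹ (p ^ 2)
          / (ellTheta (A ^ 2 * b * q ^ 3 * (q ^ n) ^ 2) (p ^ 2)
            * ellTheta (A ^ 2 * b * q ^ 5 * (q ^ n) ^ 2) (p ^ 2)
            / ellTheta (A ^ 2 * b * q ^ 3) (p ^ 2))) * (q ^ n * q) := by
  have e : (q ^ 2) ^ n = (q ^ n) ^ 2 := by rw [← pow_mul, mul_comm 2 n, pow_mul]
  have s1 : ellFac (A * b * q ^ 3) q p (n + 1) = ellFac (A * b * q) q p n *
      (ellTheta (A * b * q * q ^ n) p * ellTheta (A * b * q ^ 2 * q ^ n) p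
        * ellTheta (A * b * q ^ 3 * q ^ n) p
        / (ellTheta (A * b * q) p * ellTheta (A * b * q ^ 2) p)) := by
    have t := ellFac_succ_left (p := p) (A * b * q) q (n + 2)
    rw [ellFac_succ_left (A * b * q * q) q (n + 1), ellFac_succ (A * b * q) q (n + 2),
      ellFac_succ (A * b * q) q (n + 1), ellFac_succ (A * b * q) q n,
      show A * b * q * q = A * b * q ^ 2 by ring, show A * b * q ^ 2 * q = A * b * q ^ 3 by ring,
      show A * b * q * q ^ (n + 1) = A * b * q ^ 2 * q ^ n by ring,
      show A * b * q * q ^ (n + 2) = A * b * q ^ 3 * q ^ n by ring] at t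
    rw [mul_div_assoc', eq_div_iff (mul_ne_zero h1 h2)]
    linear_combination -t
  have s2 : ellFac (b * q ^ 2)⁻¹ q p (n + 1) = ellFac b⁻¹ q p n
      * (ellTheta (b * q ^ 2)⁻¹ p * ellTheta (b * q)⁻¹ p / ellTheta (b⁻¹ * q ^ n / q) p) := by
    have t := ellFac_succ_left (p := p) (b * q ^ 2)⁻¹ q (n + 1)
    have e1 : (b * q ^ 2)⁻¹ * q = (b * q)⁻¹ := by field_simp
    have e2 : (b * q)⁻¹ * q = b⁻¹ := by field_simp
    rw [ellFac_succ, e1, ellFac_succ_left (b * q)⁻¹ q n, e2,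
      show (b * q ^ 2)⁻¹ * q ^ (n + 1) = b⁻¹ * q ^ n / q by field_simp; ring] at t
    rw [mul_div_assoc', eq_div_iff h3, t]
    ring
  have s3 : ellFac (A ^ 2 * b * q ^ 5) (q ^ 2) (p ^ 2) (n + 1)
      = ellFac (A ^ 2 * b * q ^ 3) (q ^ 2) (p ^ 2) n
        * (ellTheta (A ^ 2 * b * q ^ 3 * (q ^ n) ^ 2) (p ^ 2)
          * ellTheta (A ^ 2 * b * q ^ 5 * (q ^ n) ^ 2) (p ^ 2)
          / ellTheta (A ^ 2 * b * q ^ 3) (p ^ 2)) := by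
    have t := ellFac_succ_left (p := p ^ 2) (A ^ 2 * b * q ^ 3) (q ^ 2) (n + 1)
    rw [ellFac_succ, ellFac_succ, show A ^ 2 * b * q ^ 3 * q ^ 2 = A ^ 2 * b * q ^ 5 by ring,
      pow_succ (q ^ 2), e,
      show A ^ 2 * b * q ^ 3 * ((q ^ n) ^ 2 * q ^ 2) = A ^ 2 * b * q ^ 5 * (q ^ n) ^ 2 by ring] at t
    rw [mul_div_assoc', eq_div_iff h4]
    linear_combination -t
  have s4 : ellFac (b * q ^ 3)⁻¹ (q ^ 2) (p ^ 2) (n + 1)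
      = ellTheta (b * q ^ 3)⁻¹ (p ^ 2) * ellFac (b * q)⁻¹ (q ^ 2) (p ^ 2) n := by
    rw [ellFac_succ_left, show (b * q ^ 3)⁻¹ * q ^ 2 = (b * q)⁻¹ by field_simp]
  rw [quadProduct, quadProductBase, show A * (b * q ^ 2) * q = A * b * q ^ 3 by ring,
    show A ^ 2 * (b * q ^ 2) * q ^ 3 = A ^ 2 * b * q ^ 5 by ring,
    show b * q ^ 2 * q = b * q ^ 3 by ring, s1, s2, s3, s4, ellFac_succ, ellFac_succ,
    neg_mul, neg_mul, show A * q ^ (2 * (n + 1)) = A * q ^ 2 * (q ^ n) ^ 2 by ring, pow_succ]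
  simp only [div_eq_mul_inv, mul_inv]
  ring

/-- The closed form with parameters `(n + 2; a, b q²)`. -/
theorem quadProduct_shift_b (hq : q ≠ 0) (n : ℕ) (h1 : ellTheta (-(A / q ^ 2)) p ≠ 0) :
    quadProduct (A / q ^ 2) (b * q ^ 2) q p (n + 2)
      = ellTheta (-(A * q ^ 2 * (q ^ n) ^ 2)) p * quadProductBase A b q p n
        * ((ellTheta (-(A / q)) p
            * (ellTheta (A * b * q * q ^ n) p * ellTheta (A * b * q ^ 2 * q ^ n) p))
          / (ellTheta (-(q * q ^ n)) p * ellTheta (-(q ^ 2 * q ^ n)) p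
            * (ellTheta (b * q ^ 2)⁻¹ p * ellTheta (b * q)⁻¹ p)))
        * (ellTheta (b * q ^ 3)⁻¹ (p ^ 2) * ellTheta ((b * q)⁻¹ * (q ^ n) ^ 2) (p ^ 2)
          / (ellTheta (A ^ 2 * b * q) (p ^ 2)
            * ellTheta (A ^ 2 * b * q ^ 3 * (q ^ n) ^ 2) (p ^ 2))) * (q ^ n * q ^ 2) := by
  have e : (q ^ 2) ^ n = (q ^ n) ^ 2 := by rw [← pow_mul, mul_comm 2 n, pow_mul]
  have e1 : (b * q ^ 2)⁻¹ * q = (b * q)⁻¹ := by field_simp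
  have e2 : (b * q)⁻¹ * q = b⁻¹ := by field_simp
  have e3 : -(A / q ^ 2) * q = -(A / q) := by field_simp
  have e4 : -(A / q) * q = -A := by field_simp
  have e5 : (b * q ^ 3)⁻¹ * q ^ 2 = (b * q)⁻¹ := by field_simp
  have s1 : ellFac (-(A / q ^ 2)) q p (n + 2)
      = ellTheta (-(A / q ^ 2)) p * (ellTheta (-(A / q)) p * ellFac (-A) q p n) := by
    rw [ellFac_succ_left, ellFac_succ_left, e3, e4]
  have s2 : ellFac (A * b * q) q p (n + 2) = ellFac (A * b * q) q p n
      * (ellTheta (A * b * q * q ^ n) p * ellTheta (A * b * q ^ 2 * q ^ n) p) := by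
    rw [ellFac_succ, ellFac_succ, show A * b * q * q ^ (n + 1) = A * b * q ^ 2 * q ^ n by ring]
    ring
  have s3 : ellFac (-q) q p (n + 2) = ellFac (-q) q p n
      * (ellTheta (-(q * q ^ n)) p * ellTheta (-(q ^ 2 * q ^ n)) p) := by
    rw [ellFac_succ, ellFac_succ, show -q * q ^ (n + 1) = -(q ^ 2 * q ^ n) by ring, neg_mul]
    ring
  have s4 : ellFac (b * q ^ 2)⁻¹ q p (n + 2)
      = ellTheta (b * q ^ 2)⁻¹ p * (ellTheta (b * q)⁻¹ p * ellFac b⁻¹ q p n) := by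
    rw [ellFac_succ_left, ellFac_succ_left, e1, e2]
  have s5 : ellFac (b * q ^ 3)⁻¹ (q ^ 2) (p ^ 2) (n + 2)
      = ellTheta (b * q ^ 3)⁻¹ (p ^ 2) * (ellFac (b * q)⁻¹ (q ^ 2) (p ^ 2) n
        * ellTheta ((b * q)⁻¹ * (q ^ n) ^ 2) (p ^ 2)) := by
    rw [ellFac_succ_left, e5, ellFac_succ, e]
  have s6 : ellFac (A ^ 2 * b * q) (q ^ 2) (p ^ 2) (n + 2)
      = ellTheta (A ^ 2 * b * q) (p ^ 2) * (ellFac (A ^ 2 * b * q ^ 3) (q ^ 2) (p ^ 2) n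
        * ellTheta (A ^ 2 * b * q ^ 3 * (q ^ n) ^ 2) (p ^ 2)) := by
    rw [ellFac_succ_left, show A ^ 2 * b * q * q ^ 2 = A ^ 2 * b * q ^ 3 by ring, ellFac_succ, e]
  rw [quadProduct, quadProductBase, show A / q ^ 2 * (b * q ^ 2) * q = A * b * q by field_simp,
    show (A / q ^ 2) ^ 2 * (b * q ^ 2) * q ^ 3 = A ^ 2 * b * q by field_simp,
    show b * q ^ 2 * q = b * q ^ 3 by ring, s1, s2, s3, s4, s5, s6,
    show A / q ^ 2 * q ^ (2 * (n + 2)) = A * q ^ 2 * (q ^ n) ^ 2 by field_simp; ring, pow_add]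
  have alg : ∀ a t x d : ℂ, t ≠ 0 → a / t * (t * x / d) = a * (x / d) := by
    intros; field_simp
  rw [mul_assoc (ellTheta (-(A / q ^ 2)) p), alg _ _ _ _ h1]
  simp only [div_eq_mul_inv, mul_inv]
  ring

end Relation

section ProductRelation

variable {p A b q : ℂ}

/-- The four closed forms satisfy the same relation as the four summands. -/
theorem quadProduct_relation (hp0 : 0 < ‖p‖) (hp1 : ‖p‖ < 1) (hA : A ≠ 0) (hb : b ≠ 0)
    (hq : q ≠ 0) (n : ℕ)
    (h1 : ellTheta (-A) p ≠ 0) (h2 : ellTheta (-(A / q ^ 2)) p ≠ 0)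
    (h3 : ellTheta (A * b * q) p ≠ 0) (h4 : ellTheta (A * b * q ^ 2) p ≠ 0)
    (h5 : ellTheta (b⁻¹ * q ^ n / q) p ≠ 0) (h6 : ellTheta (b⁻¹ * q ^ n) p ≠ 0)
    (h7 : ellTheta (A ^ 2 * b * q) (p ^ 2) ≠ 0) (h8 : ellTheta (A ^ 2 * b * q ^ 3) (p ^ 2) ≠ 0)
    (h9 : ellTheta (A ^ 2 * b * q ^ 3 * (q ^ n) ^ 2) (p ^ 2) ≠ 0)
    (h10 : ellTheta (A ^ 2 * b * q ^ 5 * (q ^ n) ^ 2) (p ^ 2) ≠ 0)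
    (h11 : ellTheta (b * q) p ≠ 0) (h12 : ellTheta (b * q ^ 2) p ≠ 0)
    (h13 : ellTheta (-(b * q ^ 2)) p ≠ 0) (h14 : ellTheta (-(A * q * (q ^ n) ^ 2)) p ≠ 0)
    (h15 : ellTheta (-(q * q ^ n)) p ≠ 0) (h16 : ellTheta (-(q ^ 2 * q ^ n)) p ≠ 0) :
    quadCoeff₁ A b q p (q ^ n) * quadProduct (A / q ^ 2) (b * q ^ 2) q p (n + 2)
      + quadCoeff₂ A b q p (q ^ n) * quadProduct A (b * q ^ 2) q p (n + 1)
      + quadCoeff₃ A b q p (q ^ n) * quadProduct A b q p (n + 1)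
      + quadCoeff₄ A b q p (q ^ n) * quadProduct A b q p n = 0 := by
  have hn2 := norm_sq_lt_one hp1
  have four := ellTheta_four_term hp0 hp1 hA hb hq (pow_ne_zero n hq) h13 h14
  rw [quadProduct_shift_b hq n h2, quadProduct_shift_ab hq n h3 h4 h5 h8, quadProduct_shift_n,
    quadProduct_eq_base]
  unfold quadCoeff₁ quadCoeff₂ quadCoeff₃ quadCoeff₄ quadClear
  have hz : q ^ n ≠ 0 := pow_ne_zero n hq
  generalize q ^ n = z at *
  generalize quadProductBase A b q p n = B
  have i1 := ellTheta_inv hp1 (x := z * q ^ 2) (by positivity)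
  have i2 := ellTheta_inv hp1 (x := z * q) (by positivity)
  have i3 := ellTheta_inv hp1 (x := b⁻¹ * z) (by positivity)
  have i4 := ellTheta_inv hp1 (x := b⁻¹ * z / q) (by positivity)
  have i5 := ellTheta_inv hp1 (x := b * q ^ 2) (by positivity)
  have i6 := ellTheta_inv hp1 (x := b * q) (by positivity)
  have i7 := ellTheta_inv hn2 (x := b * q ^ 3) (by positivity)
  rw [show (b⁻¹ * z)⁻¹ = b / z by field_simp] at i3
  rw [show (b⁻¹ * z / q)⁻¹ = b * q / z by field_simp] at i4
  have s1 := ellTheta_sq hp1 (q ^ 2 * z)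
  have s2 := ellTheta_sq hp1 (q * z)
  have s3 := ellTheta_sq hp1 (A * z)
  have s4 := ellTheta_sq hp1 (A * b * q)
  have s5 := ellTheta_sq hp1 (A * b * q ^ 2)
  rw [show (q ^ 2 * z) ^ 2 = q ^ 4 * z ^ 2 by ring] at s1
  rw [show (q * z) ^ 2 = q ^ 2 * z ^ 2 by ring] at s2
  rw [show (A * z) ^ 2 = A ^ 2 * z ^ 2 by ring] at s3
  rw [show (A * b * q) ^ 2 = A ^ 2 * b ^ 2 * q ^ 2 by ring] at s4
  rw [show (A * b * q ^ 2) ^ 2 = A ^ 2 * b ^ 2 * q ^ 4 by ring] at s5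
  rw [show z ^ 2 / (b * q) = (b * q)⁻¹ * z ^ 2 by ring, s2, s3] at four
  rw [i1, i2, i3, i4, i5, i6, i7, s1, s4, s5, mul_comm z (q ^ 2), mul_comm z q]
  clear i1 i2 i3 i4 i5 i6 i7 s1 s2 s3 s4 s5 h2
  generalize ellTheta (-A) p = t1 at *
  generalize ellTheta (A * b * q) p = t3 at *
  generalize ellTheta (A * b * q ^ 2) p = t4 at *
  generalize ellTheta (b⁻¹ * z / q) p = t5 at *
  generalize ellTheta (b⁻¹ * z) p = t6 at *
  generalize ellTheta (A ^ 2 * b * q) (p ^ 2) = t7 at *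
  generalize ellTheta (A ^ 2 * b * q ^ 3) (p ^ 2) = t8 at *
  generalize ellTheta (A ^ 2 * b * q ^ 3 * z ^ 2) (p ^ 2) = t9 at *
  generalize ellTheta (A ^ 2 * b * q ^ 5 * z ^ 2) (p ^ 2) = t10 at *
  generalize ellTheta (b * q) p = t11 at *
  generalize ellTheta (b * q ^ 2) p = t12 at *
  generalize ellTheta (-(b * q ^ 2)) p = t13 at *
  generalize ellTheta (-(q * z)) p = t15 at *
  generalize ellTheta (-(q ^ 2 * z)) p = t16 at *
  generalize ellTheta (q * z) p = u1 at *
  generalize ellTheta (q ^ 2 * z) p = u2 at *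
  generalize ellTheta (A * z) p = u3 at *
  generalize ellTheta (-(A * z)) p = u4 at *
  generalize ellTheta (-(A * b * q)) p = u5 at *
  generalize ellTheta (-(A * b * q ^ 2)) p = u6 at *
  generalize ellTheta (A * q * z ^ 2) p = u7 at *
  generalize ellTheta (b * q ^ 3) (p ^ 2) = u8 at *
  generalize ellTheta (b * q ^ 3 * z ^ 2) (p ^ 2) = u9 at *
  generalize ellTheta (A ^ 2 * b ^ 2 * q ^ 4 * z ^ 2) (p ^ 2) = u10 at *
  generalize ellTheta ((b * q)⁻¹ * z ^ 2) (p ^ 2) = u11 at *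
  generalize ellTheta (-(A / q)) p = u12 at *
  generalize ellTheta (-(A * z ^ 2)) p = u13 at *
  generalize ellTheta (-(A * b * q ^ 3 * z ^ 2)) p = u14 at *
  generalize ellTheta (-q) p = u15 at *
  generalize ellTheta (-(A * q ^ 2 * z ^ 2)) p = u16 at *
  generalize ellTheta (b / q) (p ^ 2) = u17 at *
  generalize ellTheta (A * b * q * z) p = v1 at *
  generalize ellTheta (A * b * q ^ 2 * z) p = v2 at *
  generalize ellTheta (A * b * q ^ 3 * z) p = v3 at *
  -- both sides of the four-term theta relation occur with the factor `F`
  set C := t8 * (-t5 / (b⁻¹ * z / q)) * v3 with hC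
  obtain ⟨F, hF⟩ : ∃ F, F = q * u17 * C * u2 * B * z * u16 * v1 * v2 / (t1 * t15 * t12 * t9) :=
    ⟨_, rfl⟩
  have r1 : q * t11 * u7 * (u2 * t16 * u10) * (u17 * t7) * C *
      (u16 * B * (u12 * (v1 * v2) / (t15 * t16 * (-t12 / (b * q ^ 2) * (-t11 / (b * q))))) *
        (-u8 / (b * q ^ 3) * u11 / (t7 * t9)) * (q ^ 2 * z))
      = -(F * (b * q ^ 2 * (u7 * u8 * (u10 * u11 * (u12 * t1))))) := by
    rw [hF]
    trans (u17 * C * u2 * B * u16 * v1 * v2 * u7 * u8 * (u10 * u11 * u12)) * (q * t11 * t16 * t7 *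
        (1 / (t15 * t16 * (-t12 / (b * q ^ 2) * (-t11 / (b * q)))) *
          (-1 / (b * q ^ 3) / (t7 * t9)) * (z * q ^ 2)))
    · ring
    trans (u17 * C * u2 * B * u16 * v1 * v2 * u7 * u8 * (u10 * u11 * u12))
        * (-(q * z * (b * q ^ 2) / (t1 * t15 * t12 * t9) * t1))
    · congr 1; field_simp
    · ring
  have r2 : -(q * t11 * u7 * (u9 * t10)) *
        (q ^ 2 * (t3 * u5 * (t4 * u6) * u17 * u3 * (-u2 / (q ^ 2 * z)))) *
      (u16 / t1 * B * (u4 * (v1 * v2 * v3 / (t3 * t4)) /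
          (t15 * (-t12 / (b * q ^ 2) * (-t11 / (b * q)) / t5))) *
        (-u8 / (b * q ^ 3) / (t9 * t10 / t8)) * (q * z))
      = F * (u7 * u8 * (u9 * (u3 * u4) * (u5 * u6))) := by
    rw [hF, hC]
    trans (u7 * u9 * u5 * u6 * u17 * u3 * u2 * u16 * B * u4 * v1 * v2 * v3 * u8)
        * (-(q * t11 * t10) * (q ^ 2 * (t3 * t4 * (-1 / (q ^ 2 * z)))) *
        (1 / t1 * (1 / (t3 * t4) / (t15 * (-t12 / (b * q ^ 2) * (-t11 / (b * q)) / t5))) *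
          (-1 / (b * q ^ 3) / (t9 * t10 / t8)) * (z * q)))
    · ring
    trans (u7 * u9 * u5 * u6 * u17 * u3 * u2 * u16 * B * u4 * v1 * v2 * v3 * u8)
        * (q * (t8 * (-t5 / (b⁻¹ * z / q))) * z
        / (t1 * t15 * t12 * t9))
    · congr 1; field_simp
    · ring
  have r3 : q ^ 4 * z ^ 2 * (u17 * t7) * (u15 * u14) * C *
        (u3 * (-t6 / (b⁻¹ * z)) * (-u2 / (q ^ 2 * z)) * v2) *
      (u16 / t1 * B * (u4 * v1 / (t15 * t6)) * (u11 / t9) * (q * z))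
      = F * (b * q ^ 2 * (t12 * t7 * (u3 * u4 * u11 * (u14 * u15)))) := by
    rw [hF]
    trans (u17 * u15 * u14 * C * u3 * u2 * v2 * u16 * B * u4 * v1 * u11)
        * (q ^ 4 * z ^ 2 * t7 * (-t6 / (b⁻¹ * z)) * (-1 / (q ^ 2 * z)) *
        (1 / t1 * (1 / (t15 * t6)) * (1 / t9) * (z * q)))
    · ring
    trans (u17 * u15 * u14 * C * u3 * u2 * v2 * u16 * B * u4 * v1 * u11)
        * (q * z / (t1 * t15 * t12 * t9) * (b * q ^ 2) * (t12 * t7))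
    · congr 1; field_simp
    · ring
  have r4 : -(q ^ 4 * z ^ 2 * (u17 * t7) * (t13 * u16) * C) *
        (-u2 / (q ^ 2 * z) * (-u1 / (q * z)) * v1 * v2) *
      (u13 / t1 * B * z)
      = -(F * (t12 * t7 * (t9 * (u1 * t15) * (u13 * t13)))) := by
    rw [hF]
    trans (u17 * t13 * u16 * C * u2 * u1 * v1 * v2 * u13 * B)
        * (-(q ^ 4 * z ^ 2 * t7) * (-1 / (q ^ 2 * z) * (-1 / (q * z))) * (1 / t1 * z))
    · ring
    trans (u17 * t13 * u16 * C * u2 * u1 * v1 * v2 * u13 * B)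
        * (-(q * z / (t1 * t15 * t12 * t9) * (t12 * t7 * t9 * t15)))
    · congr 1; field_simp
    · ring
  rw [r1, r2, r3, r4]
  linear_combination F * four

end ProductRelation

/-! ### The summation for generic parameters -/

section Generic

/-- `x` is nonzero and its square lies outside the multiplicative group generated by `q` and `p`;
in particular neither `x` nor `-x` belongs to that group. -/
def AvoidsLattice (q p x : ℂ) : Prop := x ≠ 0 ∧ ∀ i m : ℤ, x ^ 2 ≠ q ^ i * p ^ m

variable {q p x : ℂ}

theorem AvoidsLattice.ne_zero (h : AvoidsLattice q p x) : x ≠ 0 := h.1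

theorem AvoidsLattice.mul_pow (hq : q ≠ 0) (h : AvoidsLattice q p x) (j : ℕ) :
    AvoidsLattice q p (x * q ^ j) := by
  refine ⟨mul_ne_zero h.1 (pow_ne_zero _ hq), fun i m e => h.2 (i - 2 * j) m ?_⟩
  have h0 : q ^ j ≠ 0 := pow_ne_zero _ hq
  rw [zpow_sub₀ hq, mul_comm 2 (j : ℤ), zpow_mul, zpow_natCast, zpow_ofNat, div_mul_eq_mul_div,
    eq_div_iff (pow_ne_zero 2 h0), ← e]
  ring

theorem AvoidsLattice.mul (hq : q ≠ 0) (h : AvoidsLattice q p x) :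
    AvoidsLattice q p (x * q) := by
  simpa using h.mul_pow hq 1

theorem AvoidsLattice.inv (h : AvoidsLattice q p x) : AvoidsLattice q p x⁻¹ := by
  refine ⟨inv_ne_zero h.1, fun i m e => h.2 (-i) (-m) ?_⟩
  rw [zpow_neg, zpow_neg, ← mul_inv, ← e, inv_pow, inv_inv]

theorem AvoidsLattice.div_pow (hq : q ≠ 0) (h : AvoidsLattice q p x) (j : ℕ) :
    AvoidsLattice q p (x / q ^ j) := by
  have := (h.inv.mul_pow hq j).inv
  rwa [mul_inv, inv_inv, ← div_eq_mul_inv] at this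

theorem AvoidsLattice.div (hq : q ≠ 0) (h : AvoidsLattice q p x) :
    AvoidsLattice q p (x / q) := by
  simpa using h.div_pow hq 1

theorem AvoidsLattice.ellTheta_ne_zero (hp0 : 0 < ‖p‖) (hp1 : ‖p‖ < 1)
    (h : AvoidsLattice q p x) : ellTheta x p ≠ 0 := fun e => by
  obtain ⟨m, hm⟩ := exists_zpow_of_ellTheta_eq_zero hp0 hp1 h.1 e
  refine h.2 0 (m * 2) ?_
  rw [hm, zpow_zero, one_mul, zpow_mul, zpow_ofNat]

theorem AvoidsLattice.ellTheta_neg_ne_zero (hp0 : 0 < ‖p‖) (hp1 : ‖p‖ < 1)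
    (h : AvoidsLattice q p x) : ellTheta (-x) p ≠ 0 := fun e => by
  obtain ⟨m, hm⟩ := exists_zpow_of_ellTheta_eq_zero hp0 hp1 (neg_ne_zero.mpr h.1) e
  refine h.2 0 (m * 2) ?_
  rw [← neg_sq, hm, zpow_zero, one_mul, zpow_mul, zpow_ofNat]

theorem AvoidsLattice.ellTheta_sq_nome_ne_zero (hp0 : 0 < ‖p‖) (hp1 : ‖p‖ < 1)
    (h : AvoidsLattice q p x) : ellTheta x (p ^ 2) ≠ 0 := fun e => by
  have := h.ellTheta_ne_zero hp0 hp1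
  rw [ellTheta_split hp0 hp1, e, zero_mul] at this
  exact this rfl

theorem AvoidsLattice.ellTheta_sq_ne_zero (hp0 : 0 < ‖p‖) (hp1 : ‖p‖ < 1)
    (h : AvoidsLattice q p x) : ellTheta (x ^ 2) (p ^ 2) ≠ 0 := by
  rw [ellTheta_sq hp1]
  exact mul_ne_zero (h.ellTheta_ne_zero hp0 hp1) (h.ellTheta_neg_ne_zero hp0 hp1)

variable {A b : ℂ}

theorem quadSummand_eq_zero (hp1 : ‖p‖ < 1) (hq : q ≠ 0) {n k : ℕ} (h : n < k) :
    quadSummand A b q p (q ^ n) k = 0 := by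
  have e : ellFac (q ^ n)⁻¹ q p k = 0 :=
    Finset.prod_eq_zero (Finset.mem_range.mpr h) (by
      rw [inv_mul_cancel₀ (pow_ne_zero n hq), ellTheta_one hp1])
  simp [quadSummand, e]

theorem ellFac_one (x : ℂ) : ellFac x q p 1 = ellTheta x p := by simp [ellFac]

theorem sum_quadSummand_zero (h : ellTheta (A ^ 2 * b ^ 2) (p ^ 2) ≠ 0)
    (h' : ellTheta (-A) p ≠ 0) :
    ∑ k ∈ Finset.range (0 + 1), quadSummand A b q p (q ^ 0) k = quadProduct A b q p 0 := by
  simp [quadSummand, quadProduct, ellFac, h, h']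

/-- The case `n = 1`: a degenerate instance (`z = q⁻¹`) of the four-term theta relation. -/
theorem sum_quadSummand_one (hp0 : 0 < ‖p‖) (hp1 : ‖p‖ < 1) (hq : q ≠ 0)
    (hA : AvoidsLattice q p A) (hb : AvoidsLattice q p b) (hAb : AvoidsLattice q p (A * b))
    (hAAb : AvoidsLattice q p (A ^ 2 * b)) (hq2 : ellTheta (q ^ 2) (p ^ 2) ≠ 0) :
    ∑ k ∈ Finset.range (1 + 1), quadSummand A b q p (q ^ 1) k = quadProduct A b q p 1 := by
  have hA0 := hA.ne_zero
  have hb0 := hb.ne_zero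
  have hn2 := norm_sq_lt_one hp1
  have hc : b / q ^ 2 * q ^ 2 = b := by field_simp
  have four := ellTheta_four_term hp0 hp1 (A := A * q ^ 2) (b := b / q ^ 2) (q := q) (z := q⁻¹)
    (by positivity) (by positivity) hq (inv_ne_zero hq)
    (by rw [hc]; exact hb.ellTheta_neg_ne_zero hp0 hp1)
    (by
      rw [show A * q ^ 2 * q * q⁻¹ ^ 2 = A * q by field_simp]
      exact (hA.mul hq).ellTheta_neg_ne_zero hp0 hp1)
  have s1 := ellTheta_sq hp1 (A * q)
  have s2 := ellTheta_sq hp1 (A * b * q)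
  have s3 := ellTheta_sq hp1 q
  have s4 := ellTheta_sq hp1 (A * b * q ^ 2)
  have i1 := ellTheta_inv hn2 (x := b * q) (by positivity)
  have i2 := ellTheta_inv hp1 (x := q) hq
  have i3 := ellTheta_inv hp1 (x := b) hb0
  have n1 := (hA.mul hq).ellTheta_neg_ne_zero hp0 hp1
  have n2 := (hA.mul hq).ellTheta_ne_zero hp0 hp1
  have n3 := (hAb.mul hq).ellTheta_neg_ne_zero hp0 hp1
  have n4 := (hb.mul hq).ellTheta_sq_nome_ne_zero hp0 hp1
  have n5 := (hAAb.mul_pow hq 3).ellTheta_sq_nome_ne_zero hp0 hp1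
  have n6 := hb.ellTheta_ne_zero hp0 hp1
  have n7 := (hAb.mul_pow hq 2).ellTheta_ne_zero hp0 hp1
  have n8 := hA.ellTheta_neg_ne_zero hp0 hp1
  have n9 := hAb.ellTheta_sq_ne_zero hp0 hp1
  rw [s3] at hq2
  rw [show A * q ^ 2 * q * q⁻¹ ^ 2 = A * q by field_simp,
    show b / q ^ 2 * q ^ 3 * q⁻¹ ^ 2 = b / q by field_simp,
    show b / q ^ 2 * q ^ 3 = b * q by field_simp,
    show (A * q ^ 2) ^ 2 * q⁻¹ ^ 2 = (A * q) ^ 2 by field_simp,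
    show A * q ^ 2 * (b / q ^ 2) * q = A * b * q by field_simp,
    show A * q ^ 2 * (b / q ^ 2) * q ^ 2 = A * b * q ^ 2 by field_simp, hc,
    show (A * q ^ 2) ^ 2 * (b / q ^ 2) ^ 2 * q ^ 4 * q⁻¹ ^ 2 = (A * b * q) ^ 2 by field_simp,
    show q⁻¹ ^ 2 / (b / q ^ 2 * q) = (b * q)⁻¹ by field_simp,
    show A * q ^ 2 / q = A * q by field_simp,
    show (A * q ^ 2) ^ 2 * (b / q ^ 2) * q = A ^ 2 * b * q ^ 3 by field_simp,
    show q ^ 2 * q⁻¹ ^ 2 = 1 by field_simp,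
    show A * q ^ 2 * (b / q ^ 2) * q ^ 3 * q⁻¹ ^ 2 = A * b * q by field_simp, ellTheta_one hn2,
    i1, s1, s2] at four
  rw [Finset.sum_range_succ, Finset.sum_range_one]
  simp only [quadSummand, quadProduct, ellFac_one, ellFac_zero, pow_one, mul_one, mul_zero,
    pow_zero, div_one]
  rw [show A ^ 2 * b ^ 2 * q ^ 4 = (A * b * q ^ 2) ^ 2 by ring, s3, s4, i2, i3,
    show b * q / q = b by field_simp, show A * b * q * q = A * b * q ^ 2 by ring,
    i1]
  rw [mul_pow] at n9
  clear s1 s2 s3 s4 i1 i2 i3 hA hb hAb hAAb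
  generalize ellTheta (A * q) p = x1 at *
  generalize ellTheta (-(A * q)) p = x2 at *
  generalize ellTheta (A * b * q) p = x3 at *
  generalize ellTheta (-(A * b * q)) p = x4 at *
  generalize ellTheta (A * b * q ^ 2) p = x5 at *
  generalize ellTheta (-(A * b * q ^ 2)) p = x6 at *
  generalize ellTheta (b * q) (p ^ 2) = x7 at *
  generalize ellTheta (b / q) (p ^ 2) = x8 at *
  generalize ellTheta b p = x9 at *
  generalize ellTheta (A ^ 2 * b * q ^ 3) (p ^ 2) = x10 at *
  generalize ellTheta (-q) p = x11 at *
  generalize ellTheta q p = x12 at *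
  generalize ellTheta (-(A * q ^ 2)) p = x13 at *
  generalize ellTheta (-A) p = x14 at *
  generalize ellTheta (A ^ 2 * b ^ 2) (p ^ 2) = x15 at *
  have key : q * (x1 * x8 * x6) + x3 * x7 * x13 = x9 * x10 * x11 := by
    refine mul_left_cancel₀ (mul_ne_zero (mul_ne_zero n2 n4) (mul_ne_zero n1 n3)) ?_
    have e : b * (-x7 / (b * q)) * q = -x7 := by field_simp
    linear_combination q * four + x1 * x2 * x4 * (x7 * x3 * x13 - x9 * x10 * x11) * e
  have h12 := left_ne_zero_of_mul hq2
  have h11 := right_ne_zero_of_mul hq2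
  have l : x5 * x6 / x15 * (x15 * x8 / (x12 * x11 * x10)) * (x1 * (-x12 / q) / (x9 * x5)) * q ^ 2
      = -(q * (x1 * x8 * x6)) / (x9 * x10 * x11) := by field_simp
  have r : x13 / x14 * (x14 * x3 / (x11 * (-x9 / b))) * (-x7 / (b * q) / x10) * q
      = x3 * x7 * x13 / (x9 * x10 * x11) := by field_simp
  rw [l, r, div_self n9, neg_div, ← sub_eq_add_neg, sub_eq_iff_eq_add, ← add_div, add_comm, key,
    div_self (mul_ne_zero (mul_ne_zero n6 n5) h11)]

/-- The quadratic summation for generic `A = a / b` and `b`, by induction on `n` along the common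
four-term relation of the two sides. -/
theorem sum_quadSummand_eq (hp0 : 0 < ‖p‖) (hp1 : ‖p‖ < 1) (hq : q ≠ 0) (n : ℕ) :
    ∀ A b : ℂ, AvoidsLattice q p A → AvoidsLattice q p b → AvoidsLattice q p (A * b) →
      AvoidsLattice q p (A ^ 2 * b) →
      (∀ j < n, ellTheta ((q ^ 2) ^ (j + 1)) (p ^ 2) ≠ 0) →
      ∑ k ∈ Finset.range (n + 1), quadSummand A b q p (q ^ n) k = quadProduct A b q p n := by
  induction n using Nat.strong_induction_on with
  | _ n ih =>
  intro A₀ b₀ hA₀ hb₀ hAb₀ hAAb₀ hqn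
  match n, ih, hqn with
  | 0, _, _ =>
    exact sum_quadSummand_zero (by rw [← mul_pow]; exact hAb₀.ellTheta_sq_ne_zero hp0 hp1)
      (hA₀.ellTheta_neg_ne_zero hp0 hp1)
  | 1, _, hqn =>
    exact sum_quadSummand_one hp0 hp1 hq hA₀ hb₀ hAb₀ hAAb₀ (by simpa using hqn 0 one_pos)
  | m + 2, ih, hqn =>
  -- recentre the relation: its top member is the one with parameters `(A / q², b q²)`
  obtain ⟨A, rfl⟩ : ∃ A, A₀ = A / q ^ 2 := ⟨A₀ * q ^ 2, by field_simp⟩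
  obtain ⟨b, rfl⟩ : ∃ b, b₀ = b * q ^ 2 := ⟨b₀ / q ^ 2, by field_simp⟩
  have hA : AvoidsLattice q p A := by
    have := hA₀.mul_pow hq 2
    rwa [show A / q ^ 2 * q ^ 2 = A by field_simp] at this
  have hb : AvoidsLattice q p b := by
    have := hb₀.div_pow hq 2
    rwa [show b * q ^ 2 / q ^ 2 = b by field_simp] at this
  have hAb : AvoidsLattice q p (A * b) := by
    rwa [show A / q ^ 2 * (b * q ^ 2) = A * b by field_simp] at hAb₀
  have hAAb : AvoidsLattice q p (A ^ 2 * b) := by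
    have := hAAb₀.mul_pow hq 2
    rwa [show (A / q ^ 2) ^ 2 * (b * q ^ 2) * q ^ 2 = A ^ 2 * b by field_simp] at this
  have ih₂ := ih (m + 1) (by omega) A (b * q ^ 2) hA hb₀
    (by rw [← mul_assoc]; exact hAb.mul_pow hq 2) (by rw [← mul_assoc]; exact hAAb.mul_pow hq 2)
    (fun j hj => hqn j (by omega))
  have ih₃ := ih (m + 1) (by omega) A b hA hb hAb hAAb (fun j hj => hqn j (by omega))
  have ih₄ := ih m (by omega) A b hA hb hAb hAAb (fun j hj => hqn j (by omega))
  have hA0 := hA.ne_zero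
  have hb0 := hb.ne_zero
  have hz : q ^ m ≠ 0 := pow_ne_zero m hq
  have θ : ∀ {x}, AvoidsLattice q p x → ellTheta x p ≠ 0 := fun h => h.ellTheta_ne_zero hp0 hp1
  have θn : ∀ {x}, AvoidsLattice q p x → ellTheta (-x) p ≠ 0 := fun h =>
    h.ellTheta_neg_ne_zero hp0 hp1
  have θ2 : ∀ {x}, AvoidsLattice q p x → ellTheta x (p ^ 2) ≠ 0 := fun h =>
    h.ellTheta_sq_nome_ne_zero hp0 hp1
  have θs : ∀ {x}, AvoidsLattice q p x → ellTheta (x ^ 2) (p ^ 2) ≠ 0 := fun h =>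
    h.ellTheta_sq_ne_zero hp0 hp1
  have mp : ∀ {x} (j : ℕ), AvoidsLattice q p x → AvoidsLattice q p (x * q ^ j) := fun j h =>
    h.mul_pow hq j
  have e2 : ∀ k : ℕ, (q ^ 2) ^ k = q ^ (2 * k) := fun k => (pow_mul q 2 k).symm
  have hbz : AvoidsLattice q p (b⁻¹ * q ^ m) := mp m hb.inv
  have hbz' : AvoidsLattice q p (b / q ^ m) := hb.div_pow hq m
  have qm1 := hqn m (by omega)
  have qm2 := hqn (m + 1) (by omega)
  have qm1' := qm1
  have qm2' := qm2
  rw [show (q ^ 2) ^ (m + 1) = (q * q ^ m) ^ 2 by rw [e2]; ring, ellTheta_sq hp1] at qm1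
  rw [show (q ^ 2) ^ (m + 1 + 1) = (q ^ 2 * q ^ m) ^ 2 by rw [e2]; ring, ellTheta_sq hp1] at qm2
  have ne1 : ellTheta (q ^ m * q ^ 2)⁻¹ p ≠ 0 := by
    rw [ellTheta_inv hp1 (by positivity), mul_comm]
    exact div_ne_zero (neg_ne_zero.mpr (left_ne_zero_of_mul qm2)) (by positivity)
  have ne2 : ellTheta (q ^ m * q)⁻¹ p ≠ 0 := by
    rw [ellTheta_inv hp1 (by positivity), mul_comm]
    exact div_ne_zero (neg_ne_zero.mpr (left_ne_zero_of_mul qm1)) (by positivity)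
  have m1 : ellTheta (b / q) (p ^ 2) ≠ 0 := θ2 (hb.div hq)
  have m2 : ellTheta (A ^ 2 * b * q) (p ^ 2) ≠ 0 := θ2 (hAAb.mul hq)
  have m3 : ellTheta (A ^ 2 * b * q ^ 3) (p ^ 2) ≠ 0 := θ2 (mp 3 hAAb)
  have m4 : ellTheta (b * q / q ^ m) p ≠ 0 := θ ((hb.mul hq).div_pow hq m)
  have m5 : ellTheta (A * b * q ^ 3 * q ^ m) p ≠ 0 := θ (mp m (mp 3 hAb))
  -- the relation can be solved for its top member
  have c1 : quadCoeff₁ A b q p (q ^ m) ≠ 0 := by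
    have t1 : ellTheta (q ^ 4 * (q ^ m) ^ 2) (p ^ 2) ≠ 0 := by
      rwa [show q ^ 4 * (q ^ m) ^ 2 = (q ^ 2) ^ (m + 1 + 1) by rw [e2]; ring]
    have t2 : ellTheta (A ^ 2 * b ^ 2 * q ^ 4 * (q ^ m) ^ 2) (p ^ 2) ≠ 0 := by
      rw [show A ^ 2 * b ^ 2 * q ^ 4 * (q ^ m) ^ 2 = (A * b * q ^ 2 * q ^ m) ^ 2 by ring]
      exact θs (mp m (mp 2 hAb))
    have t3 : ellTheta (A * q * (q ^ m) ^ 2) p ≠ 0 := by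
      rw [← pow_mul]; exact θ (mp _ (hA.mul hq))
    exact mul_ne_zero (mul_ne_zero (mul_ne_zero (mul_ne_zero (mul_ne_zero hq (θ (hb.mul hq))) t3)
      (mul_ne_zero t1 t2)) (mul_ne_zero m1 m2)) (mul_ne_zero (mul_ne_zero m3 m4) m5)
  have prod := quadProduct_relation hp0 hp1 hA0 hb0 hq m (θn hA) (θn (hA.div_pow hq 2))
    (θ (hAb.mul hq)) (θ (mp 2 hAb)) (θ (hbz.div hq)) (θ hbz) m2 m3
    (by rw [← pow_mul]; exact θ2 (mp _ (mp 3 hAAb)))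
    (by rw [← pow_mul]; exact θ2 (mp _ (mp 5 hAAb))) (θ (hb.mul hq)) (θ (mp 2 hb))
    (θn (mp 2 hb)) (by rw [← pow_mul]; exact θn (mp _ (hA.mul hq)))
    (right_ne_zero_of_mul qm1) (right_ne_zero_of_mul qm2)
  -- the summand with parameters `(a q², b q²)` enters with its index shifted by one
  let g : ℕ → ℂ := fun k => Nat.casesOn k 0 fun j => quadSummand A (b * q ^ 2) q p (q ^ m * q) j
  have term : ∀ k ∈ Finset.range (m + 3),
      quadCoeff₁ A b q p (q ^ m) * quadSummand (A / q ^ 2) (b * q ^ 2) q p (q ^ m * q ^ 2) k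
      + quadCoeff₂ A b q p (q ^ m) * g k
      + quadCoeff₃ A b q p (q ^ m) * quadSummand A b q p (q ^ m * q) k
      + quadCoeff₄ A b q p (q ^ m) * quadSummand A b q p (q ^ m) k = 0 := by
    intro k hk
    have hk' : k < m + 3 := Finset.mem_range.mp hk
    refine quadCoeff_relation hp0 hp1 hA0 hb0 hq hz k
      (quadSummand_shift_b hq hz k m1 (by rw [e2]; exact θ2 (mp _ (hAAb.mul hq))) m2) ?_
      (quadSummand_shift_n hq hz k (θ (mp m hA)) (θ hbz') (θ (mp k hbz')) ne1
        (θ (mp m (mp 2 hAb))) (θ (mp k (mp m (mp 2 hAb)))))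
      (quadSummand_eq_common hq hz k ne1 ne2 (θ (mp m (hAb.mul hq))) (θ (mp m (mp 2 hAb)))
        (θ (mp k (mp m (hAb.mul hq)))) (θ (mp k (mp m (mp 2 hAb)))))
    cases k with
    | zero => simp [g, ellTheta_one (norm_sq_lt_one hp1)]
    | succ j =>
      refine quadSummand_shift_ab hq hz j ?_ ?_ ?_ m3 m4 m5 (hqn j (by omega))
      · rw [← mul_pow]; exact θs hAb
      · rw [← mul_pow, ← mul_pow]; exact θs (hAb.mul hq)
      · rw [show A ^ 2 * b ^ 2 * q ^ 4 = (A * b * q ^ 2) ^ 2 by ring]; exact θs (mp 2 hAb)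
  -- summing the relation over `k ≤ m + 2`, the terms beyond the natural range vanish
  have total := Finset.sum_eq_zero term
  rw [Finset.sum_add_distrib, Finset.sum_add_distrib, Finset.sum_add_distrib, ← Finset.mul_sum,
    ← Finset.mul_sum, ← Finset.mul_sum, ← Finset.mul_sum, Finset.sum_range_succ' g,
    Finset.sum_range_succ (fun k => quadSummand A b q p (q ^ m * q) k),
    Finset.sum_range_succ (fun k => quadSummand A b q p (q ^ m) k),
    Finset.sum_range_succ (fun k => quadSummand A b q p (q ^ m) k),
    ← pow_succ, ← pow_add, quadSummand_eq_zero hp1 hq (n := m + 1) (by omega),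
    quadSummand_eq_zero hp1 hq (n := m) (by omega),
    quadSummand_eq_zero hp1 hq (n := m) (by omega)] at total
  have hg : ∑ k ∈ Finset.range (m + 2), g (k + 1) = quadProduct A (b * q ^ 2) q p (m + 1) := ih₂
  rw [hg, show g 0 = 0 from rfl, add_zero, add_zero, add_zero, add_zero, ih₃, ih₄, ← prod] at total
  refine mul_left_cancel₀ c1 ?_
  linear_combination total

end Generic

/-! ### Passage to arbitrary parameters -/

section Limit

variable {p q : ℂ}

theorem ContinuousAt.ellTheta {f : ℝ → ℂ} {t : ℝ} (hp1 : ‖p‖ < 1) (hf : ContinuousAt f t)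
    (h0 : f t ≠ 0) : ContinuousAt (fun s => _root_.ellTheta (f s) p) t :=
  (continuousAt_ellTheta hp1 h0).comp hf

theorem ContinuousAt.ellFac {f : ℝ → ℂ} {t : ℝ} (hp1 : ‖p‖ < 1) (hq : q ≠ 0)
    (hf : ContinuousAt f t) (h0 : f t ≠ 0) (k : ℕ) :
    ContinuousAt (fun s => _root_.ellFac (f s) q p k) t := by
  unfold _root_.ellFac
  exact tendsto_finsetProd _ fun j _ =>
    (hf.mul continuousAt_const).ellTheta hp1 (mul_ne_zero h0 (pow_ne_zero j hq))

theorem ellFac_ne_zero_of_le {x : ℂ} {k n : ℕ} (hkn : k ≤ n) (h : ellFac x q p n ≠ 0) :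
    ellFac x q p k ≠ 0 := by
  rw [ellFac, Finset.prod_ne_zero_iff] at h ⊢
  exact fun j hj => h j (Finset.mem_range.mpr ((Finset.mem_range.mp hj).trans_le hkn))

variable {A b : ℝ → ℂ} {t : ℝ} {z : ℂ}

theorem continuousAt_quadSummand (hp1 : ‖p‖ < 1) (hq : q ≠ 0) (hz : z ≠ 0)
    (hA : ContinuousAt A t) (hb : ContinuousAt b t) (hA0 : A t ≠ 0) (hb0 : b t ≠ 0) (k : ℕ)
    (h1 : ellTheta (A t ^ 2 * b t ^ 2) (p ^ 2) ≠ 0)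
    (h2 : ellFac (q ^ 2) (q ^ 2) (p ^ 2) k ≠ 0)
    (h3 : ellFac (A t ^ 2 * b t * q ^ 3) (q ^ 2) (p ^ 2) k ≠ 0)
    (h4 : ellFac (b t * q / z) q p k ≠ 0) (h5 : ellFac (A t * b t * q * z) q p k ≠ 0) :
    ContinuousAt (fun s => quadSummand (A s) (b s) q p z k) t := by
  have hn2 := norm_sq_lt_one hp1
  have hq2 : q ^ 2 ≠ 0 := pow_ne_zero 2 hq
  have c (f : ℝ → ℂ) (hf : ContinuousAt f t) (h : f t ≠ 0) :
      ContinuousAt (fun s => ellTheta (f s) (p ^ 2)) t := hf.ellTheta hn2 h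
  have d (f : ℝ → ℂ) (hf : ContinuousAt f t) (h : f t ≠ 0) :
      ContinuousAt (fun s => ellFac (f s) (q ^ 2) (p ^ 2) k) t := hf.ellFac hn2 hq2 h k
  have e (f : ℝ → ℂ) (hf : ContinuousAt f t) (h : f t ≠ 0) :
      ContinuousAt (fun s => ellFac (f s) q p k) t := hf.ellFac hp1 hq h k
  have c1 := c (fun s => A s ^ 2 * b s ^ 2 * q ^ (4 * k)) (by fun_prop) (by positivity)
  have c2 := c (fun s => A s ^ 2 * b s ^ 2) (by fun_prop) (by positivity)
  have d1 := d (fun s => A s ^ 2 * b s ^ 2) (by fun_prop) (by positivity)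
  have d2 := d (fun s => b s / q) (by fun_prop) (by positivity)
  have d3 := d (fun s => A s ^ 2 * b s * q ^ 3) (by fun_prop) (by positivity)
  have e1 := e (fun s => A s * z) (by fun_prop) (by positivity)
  have e2 := e (fun s => b s * q / z) (by fun_prop) (by positivity)
  have e3 := e (fun s => A s * b s * q * z) (by fun_prop) (by positivity)
  exact (((c1.div c2 h1).mul ((d1.mul d2).div (continuousAt_const.mul d3) (mul_ne_zero h2 h3))).mul
    ((e1.mul continuousAt_const).div (e2.mul e3) (mul_ne_zero h4 h5))).mul continuousAt_const

theorem continuousAt_quadProduct (hp1 : ‖p‖ < 1) (hq : q ≠ 0)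
    (hA : ContinuousAt A t) (hb : ContinuousAt b t) (hA0 : A t ≠ 0) (hb0 : b t ≠ 0) (n : ℕ)
    (h1 : ellTheta (-A t) p ≠ 0) (h2 : ellFac (-q) q p n ≠ 0) (h3 : ellFac (b t)⁻¹ q p n ≠ 0)
    (h4 : ellFac (A t ^ 2 * b t * q ^ 3) (q ^ 2) (p ^ 2) n ≠ 0) :
    ContinuousAt (fun s => quadProduct (A s) (b s) q p n) t := by
  have hn2 := norm_sq_lt_one hp1
  have hq2 : q ^ 2 ≠ 0 := pow_ne_zero 2 hq
  have hAn : -A t ≠ 0 := neg_ne_zero.mpr hA0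
  have c (f : ℝ → ℂ) (hf : ContinuousAt f t) (h : f t ≠ 0) :
      ContinuousAt (fun s => ellTheta (f s) p) t := hf.ellTheta hp1 h
  have d (f : ℝ → ℂ) (hf : ContinuousAt f t) (h : f t ≠ 0) :
      ContinuousAt (fun s => ellFac (f s) (q ^ 2) (p ^ 2) n) t := hf.ellFac hn2 hq2 h n
  have e (f : ℝ → ℂ) (hf : ContinuousAt f t) (h : f t ≠ 0) :
      ContinuousAt (fun s => ellFac (f s) q p n) t := hf.ellFac hp1 hq h n
  have c1 := c (fun s => -(A s * q ^ (2 * n))) (by fun_prop) (neg_ne_zero.mpr (by positivity))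
  have c2 := c (fun s => -A s) (by fun_prop) hAn
  have e1 := e (fun s => -A s) (by fun_prop) hAn
  have e2 := e (fun s => A s * b s * q) (by fun_prop) (by positivity)
  have e3 := e (fun s => (b s)⁻¹) (hb.inv₀ hb0) (inv_ne_zero hb0)
  have d1 := d (fun s => (b s * q)⁻¹) ((hb.mul continuousAt_const).inv₀ (mul_ne_zero hb0 hq))
    (by positivity)
  have d2 := d (fun s => A s ^ 2 * b s * q ^ 3) (by fun_prop) (by positivity)
  exact (((c1.div c2 h1).mul ((e1.mul e2).div (continuousAt_const.mul e3) (mul_ne_zero h2 h3))).mul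
    (d1.div d2 h4)).mul continuousAt_const

/-- Along `t ↦ c exp (r t)` with `r ≠ 0` all but countably many points avoid the lattice. -/
theorem countable_not_avoidsLattice (q p : ℂ) {c : ℂ} (hc : c ≠ 0) {r : ℝ} (hr : r ≠ 0) :
    {t : ℝ | ¬ AvoidsLattice q p (c * Complex.exp ((r * t : ℝ) : ℂ))}.Countable := by
  have hsub : {t : ℝ | ¬ AvoidsLattice q p (c * Complex.exp ((r * t : ℝ) : ℂ))}
      ⊆ ⋃ im : ℤ × ℤ, {t : ℝ | (c * Complex.exp ((r * t : ℝ) : ℂ)) ^ 2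
        = q ^ im.1 * p ^ im.2} := by
    intro t ht
    simp only [Set.mem_ofPred_eq, AvoidsLattice, not_and, not_forall, not_not] at ht
    obtain ⟨i, m, h⟩ := ht (mul_ne_zero hc (Complex.exp_ne_zero _))
    exact Set.mem_iUnion.mpr ⟨(i, m), h⟩
  refine (Set.countable_iUnion fun im => Set.Subsingleton.countable ?_).mono hsub
  intro s hs t ht
  have h := congrArg norm (hs.trans ht.symm)
  simp only [norm_pow, norm_mul, Complex.norm_exp_ofReal] at h
  have h' := (pow_left_inj₀ (by positivity) (by positivity) two_ne_zero).mp h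
  exact mul_left_cancel₀ hr (Real.exp_injective (mul_left_cancel₀ (norm_ne_zero_iff.mpr hc) h'))

/-- The quadratic summation whenever no denominator vanishes. Generic parameters are dense on the
curve `t ↦ (A exp (-2 t), b exp (3 t))`, on which `A`, `b`, `A b` and `A² b` are all moved. -/
theorem sum_quadSummand_eq_quadProduct (hp0 : 0 < ‖p‖) (hp1 : ‖p‖ < 1) (hq : q ≠ 0) (n : ℕ)
    {A b : ℂ} (hA : A ≠ 0) (hb : b ≠ 0)
    (h1 : ellTheta (A ^ 2 * b ^ 2) (p ^ 2) ≠ 0)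
    (h2 : ellFac (q ^ 2) (q ^ 2) (p ^ 2) n ≠ 0)
    (h3 : ellFac (A ^ 2 * b * q ^ 3) (q ^ 2) (p ^ 2) n ≠ 0)
    (h4 : ellFac (b * q / q ^ n) q p n ≠ 0) (h5 : ellFac (A * b * q * q ^ n) q p n ≠ 0)
    (h6 : ellTheta (-A) p ≠ 0) (h7 : ellFac (-q) q p n ≠ 0) (h8 : ellFac b⁻¹ q p n ≠ 0) :
    ∑ k ∈ Finset.range (n + 1), quadSummand A b q p (q ^ n) k = quadProduct A b q p n := by
  set As : ℝ → ℂ := fun t => A * Complex.exp (((-2) * t : ℝ) : ℂ) with hAs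
  set bs : ℝ → ℂ := fun t => b * Complex.exp ((3 * t : ℝ) : ℂ) with hbs
  have hAs0 : As 0 = A := by simp [hAs]
  have hbs0 : bs 0 = b := by simp [hbs]
  have hAc : Continuous As := by fun_prop
  have hbc : Continuous bs := by fun_prop
  have cL : ContinuousAt (fun t => ∑ k ∈ Finset.range (n + 1),
      quadSummand (As t) (bs t) q p (q ^ n) k) 0 := by
    refine tendsto_finsetSum _ fun k hk => ?_
    have hkn : k ≤ n := by have := Finset.mem_range.mp hk; omega
    refine continuousAt_quadSummand hp1 hq (pow_ne_zero n hq) hAc.continuousAt hbc.continuousAt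
      ?_ ?_ k ?_ (ellFac_ne_zero_of_le hkn h2) ?_ ?_ ?_
    all_goals simp only [hAs0, hbs0]
    · exact hA
    · exact hb
    · exact h1
    · exact ellFac_ne_zero_of_le hkn h3
    · exact ellFac_ne_zero_of_le hkn h4
    · exact ellFac_ne_zero_of_le hkn h5
  have cR : ContinuousAt (fun t => quadProduct (As t) (bs t) q p n) 0 := by
    refine continuousAt_quadProduct hp1 hq hAc.continuousAt hbc.continuousAt ?_ ?_ n ?_ h7 ?_ ?_
    all_goals simp only [hAs0, hbs0]
    all_goals assumption
  have hAb : ∀ t, As t * bs t = A * b * Complex.exp ((1 * t : ℝ) : ℂ) := fun t => by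
    rw [show ((1 * t : ℝ) : ℂ) = (((-2) * t : ℝ) : ℂ) + ((3 * t : ℝ) : ℂ) by push_cast; ring,
      Complex.exp_add]
    ring
  have hAAb : ∀ t, As t ^ 2 * bs t = A ^ 2 * b * Complex.exp (((-1) * t : ℝ) : ℂ) := fun t => by
    rw [show (((-1) * t : ℝ) : ℂ)
        = (((-2) * t : ℝ) : ℂ) + (((-2) * t : ℝ) : ℂ) + ((3 * t : ℝ) : ℂ) by push_cast; ring,
      Complex.exp_add, Complex.exp_add]
    ring
  have bad := (((countable_not_avoidsLattice q p hA (r := -2) (by norm_num)).union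
    (countable_not_avoidsLattice q p hb (r := 3) (by norm_num))).union
    ((countable_not_avoidsLattice q p (mul_ne_zero hA hb) (r := 1) one_ne_zero).union
    (countable_not_avoidsLattice q p (mul_ne_zero (pow_ne_zero 2 hA) hb) (r := -1)
      (by norm_num))))
  have freq : ∃ᶠ t in nhds (0 : ℝ), ∑ k ∈ Finset.range (n + 1),
      quadSummand (As t) (bs t) q p (q ^ n) k = quadProduct (As t) (bs t) q p n := by
    refine (mem_closure_iff_frequently.mp (bad.dense_compl ℝ 0)).mono fun t ht => ?_
    simp only [Set.mem_compl_iff, Set.mem_union, Set.mem_ofPred_eq, not_or, not_not] at ht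
    obtain ⟨⟨g1, g2⟩, g3, g4⟩ := ht
    rw [← hAb] at g3
    rw [← hAAb] at g4
    refine sum_quadSummand_eq hp0 hp1 hq n _ _ g1 g2 g3 g4 fun j hj => ?_
    rw [pow_succ']
    exact Finset.prod_ne_zero_iff.mp h2 j (Finset.mem_range.mpr hj)
  have := tendsto_nhds_unique_of_frequently_eq cL cR freq
  simpa only [hAs0, hbs0] using this

end Limit

theorem mainTheorem2 (n : ℕ) (a b q p : ℂ)
    (ha : a ≠ 0) (hb : b ≠ 0) (hq : q ≠ 0) (hp0 : 0 < ‖p‖) (hp1 : ‖p‖ < 1)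
    -- the denominators on the left-hand side do not vanish
    (hL1 : ellTheta (a ^ 2) (p ^ 2) ≠ 0)
    (hL2 : ellFac (q ^ 2) (q ^ 2) (p ^ 2) n ≠ 0)
    (hL3 : ellFac (a ^ 2 * q ^ 3 / b) (q ^ 2) (p ^ 2) n ≠ 0)
    (hL4 : ellFac (b * q ^ (1 - (n : ℤ))) q p n ≠ 0)
    (hL5 : ellFac (a * q ^ (n + 1)) q p n ≠ 0)
    -- the remaining denominators on the right-hand side do not vanish
    (hR1 : ellTheta (-a / b) p ≠ 0)
    (hR2 : ellFac (-q) q p n ≠ 0)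
    (hR3 : ellFac (1 / b) q p n ≠ 0) :
    ∑ k ∈ Finset.range (n + 1),
        ellTheta (a ^ 2 * q ^ (4 * k)) (p ^ 2) / ellTheta (a ^ 2) (p ^ 2)
        * ((ellFac (a ^ 2) (q ^ 2) (p ^ 2) k * ellFac (b / q) (q ^ 2) (p ^ 2) k)
          / (ellFac (q ^ 2) (q ^ 2) (p ^ 2) k
              * ellFac (a ^ 2 * q ^ 3 / b) (q ^ 2) (p ^ 2) k))
        * ((ellFac (a * q ^ n / b) q p k * ellFac (q ^ (-(n : ℤ))) q p k)
          / (ellFac (b * q ^ (1 - (n : ℤ))) q p k * ellFac (a * q ^ (n + 1)) q p k))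
        * q ^ (2 * k)
      = ellTheta (-a * q ^ (2 * n) / b) p / ellTheta (-a / b) p
        * ((ellFac (-a / b) q p n * ellFac (a * q) q p n)
          / (ellFac (-q) q p n * ellFac (1 / b) q p n))
        * (ellFac (1 / (b * q)) (q ^ 2) (p ^ 2) n
          / ellFac (a ^ 2 * q ^ 3 / b) (q ^ 2) (p ^ 2) n)
        * q ^ n := by
  have e1 : a ^ 2 = (a / b) ^ 2 * b ^ 2 := by field_simp
  have e2 : a ^ 2 * q ^ 3 / b = (a / b) ^ 2 * b * q ^ 3 := by field_simp
  have e3 : b * q ^ (1 - (n : ℤ)) = b * q / q ^ n := by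
    rw [zpow_sub₀ hq, zpow_one, zpow_natCast, mul_div_assoc]
  have e4 : a * q ^ (n + 1) = a / b * b * q * q ^ n := by field_simp; ring
  have e5 : a * q ^ n / b = a / b * q ^ n := by ring
  have e6 : q ^ (-(n : ℤ)) = (q ^ n)⁻¹ := by rw [zpow_neg, zpow_natCast]
  have e7 : -a / b = -(a / b) := neg_div b a
  have e8 : -a * q ^ (2 * n) / b = -(a / b * q ^ (2 * n)) := by ring
  have e9 : a * q = a / b * b * q := by field_simp
  rw [one_div] at hR3
  rw [e2] at hL3
  rw [e1] at hL1
  rw [e3] at hL4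
  rw [e4] at hL5
  rw [e7] at hR1
  have main := sum_quadSummand_eq_quadProduct hp0 hp1 hq n (div_ne_zero ha hb) hb hL1 hL2 hL3 hL4
    hL5 hR1 hR2 hR3
  unfold quadSummand quadProduct at main
  simp only [e2, e3, e4, e5, e6, e7, e8, e9, one_div]
  simp only [e1]
  exact main
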